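/- Let $D\subset\mathbb R^d$ be a compact set with nonempty interior (hence positive Lebesgue measure), and let $w:D\to[0,\infty)$ be a probability density on $D$, continuous on the interior of $D$, with $0<\int_D p^2w\,dz<\infty$ for every nonzero polynomial $p$. Let $\mu_D=(2\pi)^{-d}(dd^cV_D^*)^d$ be the pluripotential equilibrium (probability) measure of $D\subset\mathbb R^d\subset\mathbb C^d$. Here $V_D^*$ is the upper semicontinuous regularization of $V_D=\sup u$, where $u$ ranges over the plurisubharmonic functions on $\mathbb C^d$ with $u\le 0$ on $D$ and $u(z)\le\max\{\log|z|,0\}+C_u$ for some constant $C_u$. Assume that $\mu_D$ has a density $v$ with respect to Lebesgue measure on $\mathbb R^d$. Let $P$ be a space of polynomials of dimension $N\ge1$ with an $L^2_w(D)$-orthonormal basis $\phi_1,\dots,\phi_N$, and put $$K=\sum_{n=1}^N\phi_n^2,\qquad \widetilde w=\frac NK\,v,\qquad R_{m,n}=\int_D\phi_m\phi_n\,\widetilde w\,dz,\qquad \|g\|_w^2=\int_D g^2w\,dz,\qquad \|g\|_{\widetilde w}^2=\int_D g^2\widetilde w\,dz .$$ Let $\lambda_{\min}(R),\lambda_{\max}(R)$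 be the extreme eigenvalues of $R$ and $\kappa(R)=\lambda_{\max}(R)/\lambda_{\min}(R)$. Let $f$ be a measurable function with $|f|\le L$ on $D$ and $\|f\|_{\widetilde w}<\infty$ (the latter is automatic if $P$ contains the constants). Let $\Pi f$ and $\widetilde\Pi f$ be its orthogonal projections onto $P$ in $L^2_w(D)$ and in $L^2_{\widetilde w}(D)$, and let $d(f)=\|\widetilde\Pi f-\Pi f\|_w$. Let $z_1,\dots,z_S$ be independent samples from $\mu_D$ and let $\widetilde\Pi^Sf$ be the Christoffel least-squares (CLS) estimator, i.e. any (measurably chosen) minimizer over $p\in P$ of $$\frac1S\sum_{s=1}^S\frac{N}{K(z_s)}\,|f(z_s)-p(z_s)|^2 .$$ Let $T_L(x)=\operatorname{sgn}(x)\min\{|x|,L\}$, let $r>0$ and $0<\delta\le\frac12$, and put $c_\delta=\delta+(1-\delta)\log(1-\delta)$. If the number of samples satisfies $$\frac{S}{N\log S}\ \ge\ \frac{1+r}{c_\delta}\cdot\frac1{\lambda_{\min}(R)},$$ then $$\mathbb E\Big[\big\|f-T_L(\widetilde\Pi^Sf)\big\|_w^2\Big]\ \le\ \|f-\Pi f\|_w^2+\frac{\varepsilon(S)}{\lambda_{\min}(R)}\,\|f-\Pi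 f\|_{\widetilde w}^2+\frac{8L^2}{S^r}+4\,\kappa^2(R)\,d^2(f),$$ where $\varepsilon(S)=\dfrac{2-2\log 2}{(1+r)\log S}\to0$ as $S\to\infty$. -/

import Mathlib

open MeasureTheory Filter Topology

noncomputable section

namespace CLS

/-! ### The pluripotential equilibrium measure -/

/-- The real points of complex `d`-space. -/
def realPoint {d : ℕ} (x : Fin d → ℝ) : Fin d → ℂ := fun j => (x j : ℂ)

/-- Plurisubharmonic functions on all of `ℂ^d`: upper semicontinuous functions with values in
`[-∞, ∞)` satisfying the sub-mean value inequality on every circle `θ ↦ a + exp (iθ) b`.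
An upper semicontinuous `u < ∞` is bounded above on the circle by some real `M`, and its mean
(possibly `-∞`) is `M` minus the mean of the nonnegative function `M - u`. -/
def IsPlurisubharmonic {d : ℕ} (u : (Fin d → ℂ) → EReal) : Prop :=
  (∀ z, u z ≠ ⊤) ∧ UpperSemicontinuous u ∧
    ∀ (a b : Fin d → ℂ) (M : ℝ),
      (∀ θ : ℝ, u (a + Complex.exp ((θ : ℂ) * Complex.I) • b) ≤ (M : EReal)) →
        u a ≤ (M : EReal) -
          (((∫⁻ θ in Set.Ioc (0 : ℝ) (2 * Real.pi),
              ((M : EReal) - u (a + Complex.exp ((θ : ℂ) * Complex.I) • b)).toENNReal) /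
            ENNReal.ofReal (2 * Real.pi) : ENNReal) : EReal)

/-- Plurisubharmonic functions of at most logarithmic growth at infinity. -/
def lelongClass (d : ℕ) : Set ((Fin d → ℂ) → EReal) :=
  {u | IsPlurisubharmonic u ∧ ∃ C : ℝ, ∀ z, u z ≤ ((max (Real.log ‖z‖) 0 + C : ℝ) : EReal)}

/-- The (unweighted) extremal function of `D ⊆ ℝ^d ⊆ ℂ^d`. -/
def extremalFun {d : ℕ} (D : Set (Fin d → ℝ)) (z : Fin d → ℂ) : EReal :=
  ⨆ u ∈ {u ∈ lelongClass d | ∀ x ∈ D, u (realPoint x) ≤ 0}, u z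

/-- The upper semicontinuous regularization of the extremal function. -/
def extremalFunStar {d : ℕ} (D : Set (Fin d → ℝ)) (z : Fin d → ℂ) : EReal :=
  limsup (extremalFun D) (𝓝 z)

/-- The entry `∂²u / ∂z_j ∂z̄_k` of the complex Hessian, where
`∂/∂z_j = (∂/∂x_j - i ∂/∂y_j) / 2` and `∂/∂z̄_k = (∂/∂x_k + i ∂/∂y_k) / 2`. -/
def complexHessian {d : ℕ} (u : (Fin d → ℂ) → ℝ) (z : Fin d → ℂ) : Matrix (Fin d) (Fin d) ℂ :=
  fun j k =>
    let H : (Fin d → ℂ) → (Fin d → ℂ) → ℝ := fun a b => fderiv ℝ (fderiv ℝ u) z a b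
    let ex : Fin d → Fin d → ℂ := fun l => Pi.single l 1
    let ey : Fin d → Fin d → ℂ := fun l => Pi.single l Complex.I
    (1 / 4 : ℂ) * (((H (ex j) (ex k) + H (ey j) (ey k) : ℝ) : ℂ) +
      Complex.I * ((H (ex j) (ey k) - H (ey j) (ex k) : ℝ) : ℂ))

/-- The Lebesgue density of `(dd^c u)^d = (2i ∂∂̄u)^d` for smooth `u`, namely
`4^d d! det (∂²u / ∂z_j ∂z̄_k)` (for `d = 1` this is the Laplacian of `u`). -/
def mongeAmpereDensity {d : ℕ} (u : (Fin d → ℂ) → ℝ) (z : Fin d → ℂ) : ℝ :=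
  4 ^ d * (d.factorial : ℝ) * (complexHessian u z).det.re

/-- `ν = (dd^c u)^d` for a locally bounded plurisubharmonic function `u` on `ℂ^d`, in the sense of
Bedford and Taylor: `ν` is the weak (vague) limit of the measures `(dd^c u_j)^d` whenever the
`u_j` are smooth plurisubharmonic functions that decrease to `u`, and such `u_j` exist. -/
def IsMongeAmpereMeasure {d : ℕ} (u : (Fin d → ℂ) → EReal) (ν : Measure (Fin d → ℂ)) : Prop :=
  let Approx : (ℕ → (Fin d → ℂ) → ℝ) → Prop := fun U =>
    (∀ j, ContDiff ℝ ((⊤ : ℕ∞) : WithTop ℕ∞) (U j)) ∧ (∀ j, IsPlurisubharmonic fun z => (U j z : EReal)) ∧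
      ∀ z, Antitone (fun j => U j z) ∧ Tendsto (fun j => (U j z : EReal)) atTop (𝓝 (u z))
  (∃ U, Approx U) ∧
    ∀ U, Approx U → ∀ χ : (Fin d → ℂ) → ℝ, Continuous χ → HasCompactSupport χ →
      Tendsto (fun j => ∫ z, χ z * mongeAmpereDensity (U j) z) atTop (𝓝 (∫ z, χ z ∂ν))

/-- `μ` is the pluripotential equilibrium measure of the compact set `D ⊆ ℝ^d`: the Borel
probability measure on `D` with `μ = (2π)^(-d) (dd^c V_D^*)^d`. -/
structure IsEquilibriumMeasure {d : ℕ} (D : Set (Fin d → ℝ)) (μ : Measure (Fin d → ℝ)) :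
    Prop where
  prob : IsProbabilityMeasure μ
  compl_eq_zero : μ Dᶜ = 0
  mongeAmpere : IsMongeAmpereMeasure (extremalFunStar D)
    (ENNReal.ofReal ((2 * Real.pi) ^ d) • μ.map realPoint)

/-! ### Weighted spaces, polynomial spaces, projections -/

/-- Admissible pairs of a compact domain and a weight function. -/
structure BoundedAdmissible {d : ℕ} (D : Set (Fin d → ℝ)) (w : (Fin d → ℝ) → ℝ) : Prop where
  isCompact : IsCompact D
  volume_ne_zero : volume D ≠ 0
  interior_nonempty : (interior D).Nonempty
  nonneg : ∀ z ∈ D, 0 ≤ w z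
  continuousOn : ContinuousOn w (interior D)
  integrableOn : ∀ p : MvPolynomial (Fin d) ℝ,
    IntegrableOn (fun z => MvPolynomial.eval z p ^ 2 * w z) D
  pos : ∀ p : MvPolynomial (Fin d) ℝ, p ≠ 0 → 0 < ∫ z in D, MvPolynomial.eval z p ^ 2 * w z

/-- The weighted inner product `∫_D g h w dz`. -/
def wInner {d : ℕ} (D : Set (Fin d → ℝ)) (w g h : (Fin d → ℝ) → ℝ) : ℝ :=
  ∫ z in D, g z * h z * w z

/-- The squared weighted norm `∫_D g² w dz`. -/
def wNormSq {d : ℕ} (D : Set (Fin d → ℝ)) (w g : (Fin d → ℝ) → ℝ) : ℝ :=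
  ∫ z in D, g z ^ 2 * w z

/-- The family `φ` of polynomials is orthonormal in `L²_w(D)`. -/
def IsOrthonormal {d N : ℕ} (D : Set (Fin d → ℝ)) (w : (Fin d → ℝ) → ℝ)
    (φ : Fin N → MvPolynomial (Fin d) ℝ) : Prop :=
  ∀ m n, wInner D w (fun z => MvPolynomial.eval z (φ m)) (fun z => MvPolynomial.eval z (φ n)) =
    if m = n then 1 else 0

/-- `p` is the `L²_w(D)`-orthogonal projection of `f` onto the polynomial space `P`. -/
def IsProjection {d : ℕ} (D : Set (Fin d → ℝ)) (w : (Fin d → ℝ) → ℝ)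
    (P : Submodule ℝ (MvPolynomial (Fin d) ℝ)) (f : (Fin d → ℝ) → ℝ)
    (p : MvPolynomial (Fin d) ℝ) : Prop :=
  p ∈ P ∧ ∀ q ∈ P,
    wInner D w (fun z => f z - MvPolynomial.eval z p) (fun z => MvPolynomial.eval z q) = 0

/-- The diagonal `K` of the reproducing kernel of `span φ`, for `φ` orthonormal. -/
def kernelDiag {d N : ℕ} (φ : Fin N → MvPolynomial (Fin d) ℝ) (z : Fin d → ℝ) : ℝ :=
  ∑ n, MvPolynomial.eval z (φ n) ^ 2

/-- The effective weight `w̃ = (N / K) v`. -/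
def effWeight {d N : ℕ} (φ : Fin N → MvPolynomial (Fin d) ℝ) (v : (Fin d → ℝ) → ℝ)
    (z : Fin d → ℝ) : ℝ :=
  (N : ℝ) / kernelDiag φ z * v z

/-- The Gramian `R` of `φ` in `L²_w̃(D)`. -/
def gramR {d N : ℕ} (D : Set (Fin d → ℝ)) (φ : Fin N → MvPolynomial (Fin d) ℝ)
    (v : (Fin d → ℝ) → ℝ) : Matrix (Fin N) (Fin N) ℝ :=
  fun m n => wInner D (effWeight φ v) (fun z => MvPolynomial.eval z (φ m))
    (fun z => MvPolynomial.eval z (φ n))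

/-- Smallest eigenvalue (of a symmetric matrix of positive size). -/
def lambdaMin {N : ℕ} (A : Matrix (Fin N) (Fin N) ℝ) : ℝ := sInf (spectrum ℝ A)

/-- Largest eigenvalue (of a symmetric matrix of positive size). -/
def lambdaMax {N : ℕ} (A : Matrix (Fin N) (Fin N) ℝ) : ℝ := sSup (spectrum ℝ A)

/-- The 2-norm condition number of a symmetric positive definite matrix. -/
def condNum {N : ℕ} (A : Matrix (Fin N) (Fin N) ℝ) : ℝ := lambdaMax A / lambdaMin A

/-! ### The Christoffel least-squares estimator -/

/-- The polynomial `∑ c_n φ_n`, as a function. -/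
def expansion {d N : ℕ} (φ : Fin N → MvPolynomial (Fin d) ℝ) (c : Fin N → ℝ)
    (z : Fin d → ℝ) : ℝ :=
  ∑ n, c n * MvPolynomial.eval z (φ n)

/-- The discrete least-squares functional `(1/S) ∑ k_s (f(z_s) - p(z_s))²`, `p = ∑ c_n φ_n`, with
Christoffel weights `k_s = N / K(z_s)`. -/
def clsCost {d N S : ℕ} (φ : Fin N → MvPolynomial (Fin d) ℝ) (f : (Fin d → ℝ) → ℝ)
    (z : Fin S → Fin d → ℝ) (c : Fin N → ℝ) : ℝ :=
  (1 / (S : ℝ)) * ∑ s, (N : ℝ) / kernelDiag φ (z s) * (f (z s) - expansion φ c (z s)) ^ 2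

/-- `c` is the coefficient vector of a Christoffel least-squares approximation of `f` from the
samples `z`. -/
def IsCLSSolution {d N S : ℕ} (φ : Fin N → MvPolynomial (Fin d) ℝ) (f : (Fin d → ℝ) → ℝ)
    (z : Fin S → Fin d → ℝ) (c : Fin N → ℝ) : Prop :=
  ∀ c' : Fin N → ℝ, clsCost φ f z c ≤ clsCost φ f z c'

/-- The truncation `T_L(x) = sgn(x) min(|x|, L)`. -/
def trunc (L x : ℝ) : ℝ := Real.sign x * min |x| L

/-- `c_δ = δ + (1 - δ) log (1 - δ)`. -/
def cDelta (δ : ℝ) : ℝ := δ + (1 - δ) * Real.log (1 - δ)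

/-- `ε(S) = (2 - 2 log 2) / ((1 + r) log S)`. -/
def epsS (r : ℝ) (S : ℕ) : ℝ := (2 - 2 * Real.log 2) / ((1 + r) * Real.log S)

end CLS

end

/-! Write the estimator as `∑ c_n φ_n` and Πf as `∑ a_n φ_n`, with residual g = f − Πf. Since |f| ≤
L on D, truncation at L cannot increase the error, and Pythagoras in L²_w gives the untruncated
error ‖g‖_w² + |c − a|². So it remains to control |c − a|² on average.

The sample Gramian is the average of independent copies of X = (N/K)φφᵀ, whose expectation under the
equilibrium measure is R. Because X is N times a projection, a matrix Chernoff bound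
(`exists_chernoff_bound`) shows that, outside an event of probability at most N exp(−c_δ S λ_min/N)
≤ S^(−r), the sample Gramian is bounded below by (1 − δ)λ_min ≥ λ_min/2. There the normal equations
yield |c − a|² ≤ (4/λ_min²)|h|², where h is the vector of empirical moments of g
(`IsCLSSolution.error_le`). On the exceptional event the truncated error is still at most 4L².

The second moment of h splits into variance and bias (`integral_empiricalMoment_sq_le`). The
variance is at most (N/S)‖g‖²_w̃, and the sampling condition turns 4N/(Sλ_min²) into ε(S)/λ_min. The
bias is R(b − a), with b the coefficients of Π̃f, because f − Π̃f is w̃-orthogonal to P; its squared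
norm is at most λ_max² d²(f), whence the factor 4κ².

The Chernoff bound rests on the Golden–Thompson inequality (`trace_exp_add_le`), which peels the
samples one at a time off the expected trace of exp(−θ ∑ X_s). Golden–Thompson itself follows from
trace inequalities for dyadic powers and the Lie–Trotter formula. -/

namespace Matrix

/-! ### Trace inequalities for dyadic powers. -/

variable {n : Type*} [Fintype n] [DecidableEq n]

lemma trace_mul_pow_comm (A B : Matrix n n ℝ) (m : ℕ) :
    ((A * B) ^ m).trace = ((B * A) ^ m).trace := by
  cases m with
  | zero => simp
  | succ k =>
    have h : A * (B * A) ^ k = (A * B) ^ k * A := by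
      induction k with
      | zero => simp
      | succ j ih => rw [pow_succ, ← mul_assoc, ih, pow_succ]; simp only [mul_assoc]
    rw [pow_succ, ← mul_assoc, trace_mul_comm, pow_succ', mul_assoc, ← h, trace_mul_comm]

omit [DecidableEq n] in
-- AM–GM applied to each product A i j * B j i.
lemma two_mul_abs_trace_mul_le (A B : Matrix n n ℝ) :
    2 * |(A * B).trace| ≤ (A * Aᵀ).trace + (B * Bᵀ).trace := by
  have e : ∀ C : Matrix n n ℝ, (C * Cᵀ).trace = ∑ i, ∑ j, C i j ^ 2 := fun C => by
    simp [trace, mul_apply, sq]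
  have h : (A * B).trace = ∑ i, ∑ j, A i j * B j i := by simp [trace, mul_apply]
  have h2 : (B * Bᵀ).trace = ∑ i, ∑ j, B j i ^ 2 := by rw [e, Finset.sum_comm]
  rw [h, h2, e]
  calc 2 * |∑ i, ∑ j, A i j * B j i| ≤ 2 * ∑ i, ∑ j, |A i j * B j i| := by
        gcongr
        exact (Finset.abs_sum_le_sum_abs _ _).trans
          (Finset.sum_le_sum fun i _ => Finset.abs_sum_le_sum_abs _ _)
    _ = ∑ i, ∑ j, 2 * |A i j * B j i| := by simp only [Finset.mul_sum]
    _ ≤ ∑ i, ∑ j, (A i j ^ 2 + B j i ^ 2) := by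
        gcongr with i _ j _
        rw [abs_mul, ← mul_assoc, ← sq_abs (A i j), ← sq_abs (B j i)]
        exact two_mul_le_add_sq _ _
    _ = _ := by simp only [Finset.sum_add_distrib]

/-- Both trace inequalities are proved by a simultaneous induction. -/
lemma abs_trace_pow_le_and_trace_mul_pow_le (j : ℕ) :
    (∀ X : Matrix n n ℝ, |(X ^ (2 * 2 ^ j)).trace| ≤ ((X * Xᵀ) ^ (2 ^ j)).trace) ∧
    (∀ A B : Matrix n n ℝ, A.IsSymm → B.IsSymm →
      ((A * B) ^ (2 ^ j)).trace ≤ (A ^ (2 ^ j) * B ^ (2 ^ j)).trace) := by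
  induction j with
  | zero =>
    refine ⟨fun X => ?_, fun A B _ _ => by simp⟩
    have := two_mul_abs_trace_mul_le X X
    simp only [pow_zero, mul_one, pow_one]
    rw [sq]
    linarith
  | succ j ih =>
    obtain ⟨hT, hG⟩ := ih
    constructor
    -- Apply the first inequality at level j to X², rotate the trace to reach (XᵀX)(XXᵀ), and
    -- separate the factors by the second inequality. AM–GM then leaves the average of two traces
    -- that agree by cyclicity.
    · intro X
      have hs1 : (Xᵀ * X).IsSymm := by simp [IsSymm]
      have hs2 : (X * Xᵀ).IsSymm := by simp [IsSymm]
      have h1 : ((X ^ 2 * (X ^ 2)ᵀ) ^ 2 ^ j).trace = (((Xᵀ * X) * (X * Xᵀ)) ^ 2 ^ j).trace := by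
        have := trace_mul_pow_comm (X * X * Xᵀ) Xᵀ (2 ^ j)
        rw [sq, transpose_mul, ← mul_assoc, this]
        simp only [mul_assoc]
      have h2 := two_mul_abs_trace_mul_le ((Xᵀ * X) ^ 2 ^ j) ((X * Xᵀ) ^ 2 ^ j)
      rw [transpose_pow, transpose_pow, hs1.eq, hs2.eq, ← pow_add, ← pow_add,
        trace_mul_pow_comm Xᵀ X] at h2
      have h3 := hT (X ^ 2)
      have h4 := hG _ _ hs1 hs2
      rw [← pow_mul, h1] at h3
      have h5 := le_abs_self ((Xᵀ * X) ^ 2 ^ j * (X * Xᵀ) ^ 2 ^ j).trace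
      rw [show 2 ^ j + 2 ^ j = 2 ^ (j + 1) by ring] at h2
      rw [show 2 * (2 * 2 ^ j) = 2 * 2 ^ (j + 1) by ring] at h3
      linarith
    -- The first inequality for X = AB produces ABBA, which is cyclically A²B²; the second
    -- inequality at level j applies to these squares.
    · intro A B hA hB
      have h1 := hT (A * B)
      have h2 := hG (A ^ 2) (B ^ 2) (by simp [IsSymm, hA.eq]) (by simp [IsSymm, hB.eq])
      have h3 : ((A * B * (A * B)ᵀ) ^ 2 ^ j).trace = ((A ^ 2 * B ^ 2) ^ 2 ^ j).trace := by
        rw [transpose_mul, hA.eq, hB.eq, ← mul_assoc, trace_mul_pow_comm]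
        simp only [sq, mul_assoc]
      rw [h3] at h1
      rw [← pow_mul, ← pow_mul] at h2
      rw [pow_succ' 2 j]
      exact (le_abs_self _).trans (h1.trans h2)

end Matrix

/-! ### The Lie–Trotter product formula. -/

section LieTrotter

variable {𝔸 : Type*} [NormedRing 𝔸] [NormedAlgebra ℝ 𝔸] [CompleteSpace 𝔸] [NormOneClass 𝔸]

omit [NormedAlgebra ℝ 𝔸] [CompleteSpace 𝔸] in
-- Telescoping. Taking C ≥ 1 allows the exponent m in place of the sharper m − 1.
lemma norm_pow_sub_pow_le {X Y : 𝔸} {C : ℝ} (hC : 1 ≤ C) (hX : ‖X‖ ≤ C) (hY : ‖Y‖ ≤ C) (m : ℕ) :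
    ‖X ^ m - Y ^ m‖ ≤ m * C ^ m * ‖X - Y‖ := by
  have hC0 : 0 ≤ C := by linarith
  induction m with
  | zero => simp
  | succ k ih =>
    have h : X ^ (k + 1) - Y ^ (k + 1) = X ^ k * (X - Y) + (X ^ k - Y ^ k) * Y := by
      rw [pow_succ, pow_succ]; noncomm_ring
    rw [h]
    calc _ ≤ ‖X ^ k‖ * ‖X - Y‖ + ‖X ^ k - Y ^ k‖ * ‖Y‖ :=
          (norm_add_le _ _).trans (add_le_add (norm_mul_le _ _) (norm_mul_le _ _))
      _ ≤ C ^ k * ‖X - Y‖ + (k * C ^ k * ‖X - Y‖) * C := by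
          gcongr
          exact (norm_pow_le _ _).trans (by gcongr)
      _ ≤ C ^ (k + 1) * ‖X - Y‖ + (k * C ^ k * ‖X - Y‖) * C := by
          gcongr
          exact Nat.le_succ k
      _ = _ := by push_cast; ring

omit [CompleteSpace 𝔸] in
lemma norm_exp_le_exp_norm (x : 𝔸) : ‖NormedSpace.exp x‖ ≤ Real.exp ‖x‖ := by
  have h : Summable fun m : ℕ => (m.factorial : ℝ)⁻¹ • ‖x‖ ^ m :=
    NormedSpace.expSeries_summable' (𝕂 := ℝ) ‖x‖
  rw [Real.exp_eq_exp_ℝ, NormedSpace.exp_eq_tsum ℝ, NormedSpace.exp_eq_tsum ℝ]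
  refine tsum_of_norm_bounded h.hasSum fun m => ?_
  rw [norm_smul, norm_inv, Real.norm_natCast, smul_eq_mul]
  gcongr
  exact norm_pow_le x m

omit [NormOneClass 𝔸] in
/-- `exp` as a power of `exp` of a fraction of the argument. -/
lemma exp_inv_smul_pow (x : 𝔸) {m : ℕ} (hm : m ≠ 0) :
    NormedSpace.exp ((m : ℝ)⁻¹ • x) ^ m = NormedSpace.exp x := by
  let : NormedAlgebra ℚ 𝔸 := NormedAlgebra.restrictScalars ℚ ℝ 𝔸
  rw [← NormedSpace.exp_nsmul, ← Nat.cast_smul_eq_nsmul ℝ, smul_smul,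
    mul_inv_cancel₀ (Nat.cast_ne_zero.2 hm), one_smul]

/-- The Lie–Trotter product formula. -/
lemma tendsto_exp_mul_exp_pow (a b : 𝔸) :
    Tendsto (fun m : ℕ => (NormedSpace.exp ((m : ℝ)⁻¹ • a) * NormedSpace.exp ((m : ℝ)⁻¹ • b)) ^ m)
      atTop (𝓝 (NormedSpace.exp (a + b))) := by
  -- One-step error. Its derivative vanishes at 0, so m‖g(1/m)‖ → 0, and m steps accumulate at most
  -- a constant multiple of this quantity.
  set g : ℝ → 𝔸 := fun t => NormedSpace.exp (t • a) * NormedSpace.exp (t • b) -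
    NormedSpace.exp (t • (a + b)) with hg
  have hd : HasDerivAt g 0 0 := by
    have h := ((hasDerivAt_exp_smul_const (𝕂 := ℝ) a (0 : ℝ)).mul
      (hasDerivAt_exp_smul_const (𝕂 := ℝ) b (0 : ℝ))).sub
      (hasDerivAt_exp_smul_const (𝕂 := ℝ) (a + b) (0 : ℝ))
    refine h.congr_deriv ?_
    simp
  have hs : Tendsto (fun m : ℕ => (m : ℝ) * ‖g (m : ℝ)⁻¹‖) atTop (𝓝 0) := by
    have h1 := hd.tendsto_slope_zero_right
    have h2 : Tendsto (fun m : ℕ => (m : ℝ)⁻¹) atTop (𝓝[>] 0) :=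
      tendsto_inv_atTop_nhdsGT_zero.comp tendsto_natCast_atTop_atTop
    have h3 := (h1.comp h2).norm
    simpa [Function.comp_def, norm_smul, hg] using h3
  rw [tendsto_iff_norm_sub_tendsto_zero]
  have hs' := hs.const_mul (Real.exp (‖a‖ + ‖b‖))
  rw [mul_zero] at hs'
  refine squeeze_zero' (Eventually.of_forall fun _ => norm_nonneg _) ?_ hs'
  filter_upwards [eventually_gt_atTop 0] with m hm
  have hm' : (0 : ℝ) < m := by exact_mod_cast hm
  have hpow := exp_inv_smul_pow (a + b) hm.ne'
  have hn : ∀ x : 𝔸, ‖(m : ℝ)⁻¹ • x‖ = (m : ℝ)⁻¹ * ‖x‖ := fun x => by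
    rw [norm_smul, norm_inv, Real.norm_natCast]
  have hC : Real.exp ((m : ℝ)⁻¹ * (‖a‖ + ‖b‖)) ^ m = Real.exp (‖a‖ + ‖b‖) := by
    rw [← Real.exp_nat_mul, ← mul_assoc, mul_inv_cancel₀ hm'.ne', one_mul]
  -- This C has C ^ m = exp(‖a‖ + ‖b‖), independent of m.
  have key := norm_pow_sub_pow_le (X := NormedSpace.exp ((m : ℝ)⁻¹ • a) *
      NormedSpace.exp ((m : ℝ)⁻¹ • b)) (Y := NormedSpace.exp ((m : ℝ)⁻¹ • (a + b)))
      (C := Real.exp ((m : ℝ)⁻¹ * (‖a‖ + ‖b‖))) (Real.one_le_exp (by positivity)) ?_ ?_ m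
  · rw [hC, hpow] at key
    calc _ ≤ _ := key
      _ = _ := by simp only [hg]; ring
  · refine (norm_mul_le _ _).trans ?_
    rw [mul_add, Real.exp_add]
    gcongr
    · exact (norm_exp_le_exp_norm _).trans_eq (by rw [hn])
    · exact (norm_exp_le_exp_norm _).trans_eq (by rw [hn])
  · refine (norm_exp_le_exp_norm _).trans ?_
    rw [hn]
    gcongr
    exact norm_add_le _ _

end LieTrotter

/-! ### The Golden–Thompson inequality. -/

namespace Matrix

variable {n : Type*} [Fintype n] [DecidableEq n]

attribute [local instance] Matrix.linftyOpNormedRing Matrix.linftyOpNormedAlgebra in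
/-- The Golden–Thompson inequality for real symmetric matrices. -/
theorem trace_exp_add_le {A B : Matrix n n ℝ} (hA : A.IsSymm) (hB : B.IsSymm) :
    (NormedSpace.exp (A + B)).trace ≤ (NormedSpace.exp A * NormedSpace.exp B).trace := by
  -- For empty `n` the identity matrix has norm 0, so the norm-one hypothesis of Lie–Trotter fails.
  cases isEmpty_or_nonempty n
  · simp [trace]
  -- The trace inequality is available only for powers 2^k, so the limit is taken along this
  -- subsequence.
  have h1 : Tendsto (fun k : ℕ => 2 ^ k) atTop (atTop : Filter ℕ) :=
    tendsto_pow_atTop_atTop_of_one_lt one_lt_two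
  have h2 := (tendsto_exp_mul_exp_pow A B).comp h1
  have h3 : Tendsto (fun M : Matrix n n ℝ => M.trace) (𝓝 (NormedSpace.exp (A + B)))
      (𝓝 (NormedSpace.exp (A + B)).trace) := (continuous_id.matrix_trace).tendsto _
  refine le_of_tendsto (h3.comp h2) (Eventually.of_forall fun k => ?_)
  have hpow : ∀ C : Matrix n n ℝ,
      NormedSpace.exp ((((2 ^ k : ℕ) : ℝ))⁻¹ • C) ^ (2 ^ k) = NormedSpace.exp C := fun C =>
    exp_inv_smul_pow C (by positivity)
  have h4 := (abs_trace_pow_le_and_trace_mul_pow_le (n := n) k).2 _ _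
    (hA.smul (((2 ^ k : ℕ) : ℝ))⁻¹).exp (hB.smul (((2 ^ k : ℕ) : ℝ))⁻¹).exp
  rw [hpow, hpow] at h4
  exact h4

end Matrix

/-! ### Spectral bounds and exponentials of symmetric matrices. -/

namespace Matrix

variable {n : Type*} [Fintype n] [DecidableEq n]

/-- Orthogonal diagonalization of a real symmetric matrix. -/
lemma IsSymm.exists_diagonalization {M : Matrix n n ℝ} (hM : M.IsSymm) :
    ∃ (U : Matrix n n ℝ) (e : n → ℝ), U * Uᵀ = 1 ∧ Uᵀ * U = 1 ∧ M = U * diagonal e * Uᵀ ∧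
      spectrum ℝ M = Set.range e := by
  have hH : M.IsHermitian := by
    rw [IsHermitian, conjTranspose_eq_transpose_of_trivial]; exact hM
  have hs : star (hH.eigenvectorUnitary : Matrix n n ℝ) =
      (hH.eigenvectorUnitary : Matrix n n ℝ)ᵀ := by
    rw [star_eq_conjTranspose, conjTranspose_eq_transpose_of_trivial]
  refine ⟨hH.eigenvectorUnitary, hH.eigenvalues, ?_, ?_, ?_, hH.spectrum_real_eq_range_eigenvalues⟩
  · rw [← hs]; exact Unitary.coe_mul_star_self _
  · rw [← hs]; exact Unitary.coe_star_mul_self _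
  · have := hH.spectral_theorem
    rw [Unitary.conjStarAlgAut_apply, hs] at this
    exact this

lemma dotProduct_mulVec_diagonalization (U : Matrix n n ℝ) (e x : n → ℝ) :
    x ⬝ᵥ (U * diagonal e * Uᵀ) *ᵥ x = ∑ i, e i * (Uᵀ *ᵥ x) i ^ 2 := by
  rw [← mulVec_mulVec, ← mulVec_mulVec, dotProduct_mulVec, ← mulVec_transpose, dotProduct]
  refine Finset.sum_congr rfl fun i _ => ?_
  rw [mulVec_diagonal]; ring

lemma dotProduct_self_mulVec_of_orthogonal {U : Matrix n n ℝ} (hU : Uᵀ * U = 1) (x : n → ℝ) :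
    (U *ᵥ x) ⬝ᵥ (U *ᵥ x) = x ⬝ᵥ x := by
  rw [dotProduct_mulVec, ← mulVec_transpose, mulVec_mulVec, hU, one_mulVec]

lemma sInf_spectrum_mul_le [Nonempty n] {M : Matrix n n ℝ} (hM : M.IsSymm) (x : n → ℝ) :
    sInf (spectrum ℝ M) * (x ⬝ᵥ x) ≤ x ⬝ᵥ M *ᵥ x := by
  obtain ⟨U, e, h1, h2, h3, h4⟩ := hM.exists_diagonalization
  rw [h4, ← dotProduct_self_mulVec_of_orthogonal (U := Uᵀ) (by simpa using h1) x]
  conv_rhs => rw [h3, dotProduct_mulVec_diagonalization]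
  rw [dotProduct, Finset.mul_sum]
  refine Finset.sum_le_sum fun i _ => ?_
  rw [sq]
  exact mul_le_mul_of_nonneg_right (csInf_le (Set.finite_range e).bddBelow ⟨i, rfl⟩)
    (mul_self_nonneg _)

lemma sInf_spectrum_pos [Nonempty n] {M : Matrix n n ℝ} (hM : M.IsSymm)
    (hpos : ∀ x, x ≠ 0 → 0 < x ⬝ᵥ M *ᵥ x) : 0 < sInf (spectrum ℝ M) := by
  obtain ⟨U, e, h1, h2, h3, h4⟩ := hM.exists_diagonalization
  rw [h4]
  obtain ⟨i, hi⟩ := (Set.range_nonempty e).csInf_mem (Set.finite_range e)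
  rw [← hi]
  have hx : U *ᵥ Pi.single i 1 ≠ 0 := fun h => by
    have := dotProduct_self_mulVec_of_orthogonal h2 (Pi.single i (1 : ℝ))
    simp [h] at this
  have := hpos _ hx
  rw [h3, dotProduct_mulVec_diagonalization, mulVec_mulVec, h2, one_mulVec] at this
  simpa [Pi.single_apply] using this

lemma dotProduct_self_mulVec_le_sSup_spectrum [Nonempty n] {M : Matrix n n ℝ} (hM : M.IsSymm)
    (hpos : 0 ≤ sInf (spectrum ℝ M)) (x : n → ℝ) :
    (M *ᵥ x) ⬝ᵥ (M *ᵥ x) ≤ sSup (spectrum ℝ M) ^ 2 * (x ⬝ᵥ x) := by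
  obtain ⟨U, e, h1, h2, h3, h4⟩ := hM.exists_diagonalization
  rw [h4] at hpos ⊢
  rw [← dotProduct_self_mulVec_of_orthogonal (U := Uᵀ) (by simpa using h1) x]
  conv_lhs => rw [h3, ← mulVec_mulVec, ← mulVec_mulVec, dotProduct_self_mulVec_of_orthogonal h2]
  rw [dotProduct, dotProduct, Finset.mul_sum]
  refine Finset.sum_le_sum fun i _ => ?_
  rw [mulVec_diagonal, mul_mul_mul_comm, ← sq, ← sq]
  have h0 : 0 ≤ e i := hpos.trans (csInf_le (Set.finite_range e).bddBelow ⟨i, rfl⟩)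
  have h5 : e i ≤ sSup (Set.range e) := le_csSup (Set.finite_range e).bddAbove ⟨i, rfl⟩
  gcongr

lemma trace_exp_diagonalization {U : Matrix n n ℝ} (h1 : U * Uᵀ = 1) (e : n → ℝ) :
    (NormedSpace.exp (U * diagonal e * Uᵀ)).trace = ∑ i, Real.exp (e i) := by
  have hU : U⁻¹ = Uᵀ := inv_eq_right_inv h1
  have h2 : Uᵀ * U = 1 := mul_eq_one_comm.1 h1
  rw [← hU, exp_conj _ _ (IsUnit.of_mul_eq_one _ h1), exp_diagonal, trace_mul_comm, hU,
    ← mul_assoc, h2, one_mul, trace_diagonal]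
  simp [Real.exp_eq_exp_ℝ]

/-- A symmetric matrix whose exponential has small trace is bounded below. -/
lemma le_dotProduct_mulVec_of_trace_exp_lt {M : Matrix n n ℝ} (hM : M.IsSymm) {θ t : ℝ}
    (hθ : 0 < θ) (h : (NormedSpace.exp (-θ • M)).trace < Real.exp (-θ * t)) (x : n → ℝ) :
    t * (x ⬝ᵥ x) ≤ x ⬝ᵥ M *ᵥ x := by
  obtain ⟨U, e, h1, h2, h3, -⟩ := hM.exists_diagonalization
  have h4 : -θ • M = U * diagonal (-θ • e) * Uᵀ := by
    rw [h3, diagonal_smul]; simp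
  rw [h4, trace_exp_diagonalization h1] at h
  rw [← dotProduct_self_mulVec_of_orthogonal (U := Uᵀ) (by simpa using h1) x]
  conv_rhs => rw [h3, dotProduct_mulVec_diagonalization]
  rw [dotProduct, Finset.mul_sum]
  refine Finset.sum_le_sum fun i _ => ?_
  -- The trace is a sum of positive exponentials of eigenvalues, so it dominates each of them.
  have h5 : Real.exp ((-θ • e) i) < Real.exp (-θ * t) :=
    (Finset.single_le_sum (f := fun i => Real.exp ((-θ • e) i))
      (fun _ _ => (Real.exp_pos _).le) (Finset.mem_univ i)).trans_lt h
  rw [Real.exp_lt_exp, Pi.smul_apply, smul_eq_mul] at h5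
  have h6 : t ≤ e i := by nlinarith
  rw [sq]
  exact mul_le_mul_of_nonneg_right h6 (mul_self_nonneg _)

attribute [local instance] Matrix.linftyOpNormedRing Matrix.linftyOpNormedAlgebra in
-- X/c is idempotent, so every positive power of X is a multiple of X and the series sums in closed
-- form. This exact formula replaces the convexity estimate usual in Chernoff arguments.
lemma exp_smul_of_mul_self_eq_smul {X : Matrix n n ℝ} {c : ℝ} (hc : c ≠ 0) (hX : X * X = c • X)
    (t : ℝ) : NormedSpace.exp (t • X) = 1 + ((Real.exp (t * c) - 1) / c) • X := by
  have h1 : HasSum (fun k : ℕ => ((k.factorial : ℝ)⁻¹) • (t • X) ^ k) (NormedSpace.exp (t • X)) :=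
    NormedSpace.exp_series_hasSum_exp' (𝕂 := ℝ) (t • X)
  have h2 : HasSum (fun k : ℕ => ((k.factorial : ℝ)⁻¹) • (t * c) ^ k) (Real.exp (t * c)) := by
    rw [Real.exp_eq_exp_ℝ]
    exact NormedSpace.exp_series_hasSum_exp' (𝕂 := ℝ) (t * c)
  -- The pattern for positive powers would give c⁻¹X at index 0; the extra summand corrects it to 1.
  have h3 := (h2.smul_const (c⁻¹ • X)).add (hasSum_ite_eq 0 (1 - c⁻¹ • X))
  have hpow : ∀ k : ℕ, X ^ (k + 1) = c ^ k • X := fun k => by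
    induction k with
    | zero => simp
    | succ k ih => rw [pow_succ, ih, smul_mul_assoc, hX, smul_smul, pow_succ]
  have h4 : (fun k : ℕ => ((k.factorial : ℝ)⁻¹) • (t • X) ^ k) = fun k : ℕ =>
      (((k.factorial : ℝ)⁻¹) • (t * c) ^ k) • (c⁻¹ • X) +
        if k = 0 then (1 - c⁻¹ • X) else 0 := by
    funext k
    cases k with
    | zero => simp
    | succ k =>
      simp only [smul_pow, hpow, Nat.succ_ne_zero, if_false, add_zero, smul_smul, smul_eq_mul]
      congr 1
      field_simp
      ring
  rw [h4] at h1
  rw [h1.unique h3]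
  rw [smul_smul, sub_div, sub_smul, one_div, ← div_eq_mul_inv]
  abel

/-- With C = exp(A/2) symmetric and exp A = C², the right-hand trace is the sum of the quadratic
form of M over the rows of C. -/
lemma mul_trace_exp_le_trace_mul_exp {M A : Matrix n n ℝ} (hA : A.IsSymm) {l : ℝ}
    (hM : ∀ x, l * (x ⬝ᵥ x) ≤ x ⬝ᵥ M *ᵥ x) :
    l * (NormedSpace.exp A).trace ≤ (M * NormedSpace.exp A).trace := by
  set C := NormedSpace.exp ((2 : ℝ)⁻¹ • A) with hC
  have hCs : Cᵀ = C := (hA.smul (2 : ℝ)⁻¹).exp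
  have h : NormedSpace.exp A = C * C := by
    rw [hC, ← exp_add_of_commute _ _ (Commute.refl _), ← add_smul]
    norm_num
  have e1 : (C * C).trace = ∑ i, C i ⬝ᵥ C i := by
    rw [trace]
    refine Finset.sum_congr rfl fun i _ => ?_
    nth_rw 2 [← hCs]
    rfl
  have e2 : (M * (C * C)).trace = ∑ i, C i ⬝ᵥ M *ᵥ C i := by
    rw [← mul_assoc, trace_mul_comm, trace]
    refine Finset.sum_congr rfl fun i _ => ?_
    nth_rw 2 [← hCs]
    rfl
  rw [h, e1, e2, Finset.mul_sum]
  exact Finset.sum_le_sum fun i _ => hM _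

lemma trace_exp_nonneg {A : Matrix n n ℝ} (hA : A.IsSymm) : 0 ≤ (NormedSpace.exp A).trace := by
  obtain ⟨U, e, h1, -, h3, -⟩ := hA.exists_diagonalization
  rw [h3, trace_exp_diagonalization h1]
  exact Finset.sum_nonneg fun _ _ => (Real.exp_pos _).le

omit [DecidableEq n] in
-- Diagonal entries of X² = cX are sums of squares of rows, so X i j ^ 2 ≤ c * X i i; the case i = j
-- gives X i i ≤ c. This supplies integrability of the random entries.
lemma abs_apply_le_of_mul_self_eq_smul {X : Matrix n n ℝ} (hs : X.IsSymm) {c : ℝ} (hc : 0 < c)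
    (hX : X * X = c • X) (i j : n) : |X i j| ≤ c := by
  have h1 : ∀ i j, X i j ^ 2 ≤ c * X i i := fun i j => by
    have h := congrFun (congrFun hX i) i
    rw [mul_apply, smul_apply, smul_eq_mul] at h
    rw [← h]
    have := Finset.single_le_sum (f := fun k => X i k * X k i)
      (fun k _ => by rw [hs.apply]; exact mul_self_nonneg _) (Finset.mem_univ j)
    simpa [hs.apply, sq] using this
  have h2 := h1 i i
  have h3 : X i i ≤ c := by by_contra hcon; push Not at hcon; nlinarith
  have h4 := h1 i j
  exact abs_le_of_sq_le_sq (h4.trans (by nlinarith)) hc.le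

end Matrix

/-! ### The matrix Chernoff bound. -/

namespace Matrix

variable {n : Type*} [Fintype n] [DecidableEq n]

attribute [local instance] Matrix.linftyOpNormedRing Matrix.linftyOpNormedAlgebra in
lemma continuous_trace_exp : Continuous fun A : Matrix n n ℝ => (NormedSpace.exp A).trace := by
  let : NormedAlgebra ℚ (Matrix n n ℝ) := NormedAlgebra.restrictScalars ℚ ℝ _
  exact (NormedSpace.exp_continuous (𝔸 := Matrix n n ℝ)).matrix_trace

lemma measurable_trace_exp {E : Type*} [MeasurableSpace E] {F : E → Matrix n n ℝ}
    (hF : ∀ i j, Measurable fun z => F z i j) :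
    Measurable fun z => (NormedSpace.exp (F z)).trace := by
  have h : Measurable fun M : n → n → ℝ => (NormedSpace.exp (Matrix.of M)).trace :=
    (show Continuous fun M : n → n → ℝ => (NormedSpace.exp (Matrix.of M)).trace from
      continuous_trace_exp).measurable
  exact h.comp (measurable_pi_lambda _ fun i => measurable_pi_lambda _ fun j => hF i j)

section Chernoff

variable {E : Type*} [MeasurableSpace E] {μ : Measure E} [IsProbabilityMeasure μ]
  {X : E → Matrix n n ℝ} {c l : ℝ}

omit [DecidableEq n] in
lemma integrable_apply_of_mul_self_eq_smul (hmeas : ∀ i j, Measurable fun z => X z i j)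
    (hsymm : ∀ z, (X z).IsSymm) (hc : 0 < c) (hX : ∀ z, X z * X z = c • X z) (i j : n) :
    Integrable (fun z => X z i j) μ :=
  Integrable.of_bound (hmeas i j).aestronglyMeasurable c
    (Eventually.of_forall fun z => abs_apply_le_of_mul_self_eq_smul (hsymm z) hc (hX z) i j)

omit [DecidableEq n] [IsProbabilityMeasure μ] in
lemma integral_dotProduct_mulVec (hint : ∀ i j, Integrable (fun z => X z i j) μ) (x : n → ℝ) :
    ∫ z, x ⬝ᵥ X z *ᵥ x ∂μ = x ⬝ᵥ (Matrix.of fun i j => ∫ z, X z i j ∂μ) *ᵥ x := by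
  simp only [dotProduct, mulVec, of_apply]
  rw [integral_finsetSum _ fun i _ => (integrable_finsetSum _ fun j _ =>
    (hint i j).mul_const _).const_mul _]
  refine Finset.sum_congr rfl fun i _ => ?_
  rw [integral_const_mul, integral_finsetSum _ fun j _ => (hint i j).mul_const _]
  simp only [integral_mul_const]

lemma mul_trace_exp_le_integral (hmeas : ∀ i j, Measurable fun z => X z i j)
    (hsymm : ∀ z, (X z).IsSymm) (hc : 0 < c) (hX : ∀ z, X z * X z = c • X z)
    (hl : ∀ x, l * (x ⬝ᵥ x) ≤ ∫ z, x ⬝ᵥ X z *ᵥ x ∂μ) {A : Matrix n n ℝ} (hA : A.IsSymm) :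
    l * (NormedSpace.exp A).trace ≤ ∫ z, (NormedSpace.exp A * X z).trace ∂μ := by
  have hint := integrable_apply_of_mul_self_eq_smul (μ := μ) hmeas hsymm hc hX
  have h := mul_trace_exp_le_trace_mul_exp (M := Matrix.of fun i j => ∫ z, X z i j ∂μ) hA (l := l)
    (fun x => (hl x).trans_eq (integral_dotProduct_mulVec hint x))
  refine h.trans_eq ?_
  rw [trace_mul_comm]
  clear h
  generalize NormedSpace.exp A = C
  simp only [trace, diag_apply, mul_apply, of_apply]
  refine Eq.symm ((integral_finsetSum _ fun i _ =>
    integrable_finsetSum _ fun j _ => (hint j i).const_mul _).trans ?_)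
  refine Finset.sum_congr rfl fun i _ => ?_
  refine (integral_finsetSum _ fun j _ => (hint j i).const_mul _).trans ?_
  simp only [integral_const_mul]

/-- Cost of one sample: Golden–Thompson splits off exp(−θX), which is affine in X by the closed
formula, so the expectation passes inside; 1 − x ≤ exp(−x) finishes. -/
lemma lintegral_trace_exp_add_le (hmeas : ∀ i j, Measurable fun z => X z i j)
    (hsymm : ∀ z, (X z).IsSymm) (hc : 0 < c) (hX : ∀ z, X z * X z = c • X z)
    (hl : ∀ x, l * (x ⬝ᵥ x) ≤ ∫ z, x ⬝ᵥ X z *ᵥ x ∂μ) {A : Matrix n n ℝ} (hA : A.IsSymm)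
    {θ : ℝ} (hθ : 0 < θ) :
    ∫⁻ z, ENNReal.ofReal (NormedSpace.exp (A + -θ • X z)).trace ∂μ ≤
      ENNReal.ofReal (Real.exp (-((1 - Real.exp (-θ * c)) / c * l)) *
        (NormedSpace.exp A).trace) := by
  set g := (1 - Real.exp (-θ * c)) / c with hg
  have hg0 : 0 ≤ g := div_nonneg (by
    rw [sub_nonneg, Real.exp_le_one_iff]; nlinarith) hc.le
  have hint := integrable_apply_of_mul_self_eq_smul (μ := μ) hmeas hsymm hc hX
  have hi : Integrable (fun z => (NormedSpace.exp A * X z).trace) μ := by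
    simp only [trace, diag_apply, mul_apply]
    exact integrable_finsetSum _ fun i _ => integrable_finsetSum _ fun j _ =>
      (hint j i).const_mul _
  have h1 : ∀ z, (NormedSpace.exp (A + -θ • X z)).trace ≤
      (NormedSpace.exp A).trace - g * (NormedSpace.exp A * X z).trace := fun z => by
    refine (trace_exp_add_le hA ((hsymm z).smul _)).trans_eq ?_
    rw [exp_smul_of_mul_self_eq_smul hc.ne' (hX z), mul_add, mul_one, trace_add, mul_smul_comm,
      trace_smul, smul_eq_mul, hg]
    ring
  have h0 : ∀ z, 0 ≤ (NormedSpace.exp (A + -θ • X z)).trace := fun z =>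
    trace_exp_nonneg (hA.add ((hsymm z).smul _))
  calc _ ≤ ∫⁻ z, ENNReal.ofReal
        ((NormedSpace.exp A).trace - g * (NormedSpace.exp A * X z).trace) ∂μ :=
        lintegral_mono fun z => ENNReal.ofReal_le_ofReal (h1 z)
    _ = ENNReal.ofReal (∫ z,
        ((NormedSpace.exp A).trace - g * (NormedSpace.exp A * X z).trace) ∂μ) :=
        (ofReal_integral_eq_lintegral_ofReal ((integrable_const _).sub (hi.const_mul _))
          (Eventually.of_forall fun z => (h0 z).trans (h1 z))).symm
    _ ≤ _ := by
        refine ENNReal.ofReal_le_ofReal ?_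
        rw [integral_sub (integrable_const _) (hi.const_mul _), integral_const_mul]
        simp only [integral_const, probReal_univ, one_smul]
        have h2 := mul_le_mul_of_nonneg_left
          (mul_trace_exp_le_integral (μ := μ) hmeas hsymm hc hX hl hA) hg0
        have h3 := mul_le_mul_of_nonneg_right (Real.add_one_le_exp (-(g * l)))
          (trace_exp_nonneg hA)
        linarith

/-- Tonelli and induction on S. The arbitrary symmetric A absorbs the sample held fixed while the
others are integrated out. -/
lemma lintegral_pi_trace_exp_le (hmeas : ∀ i j, Measurable fun z => X z i j)
    (hsymm : ∀ z, (X z).IsSymm) (hc : 0 < c) (hX : ∀ z, X z * X z = c • X z)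
    (hl : ∀ x, l * (x ⬝ᵥ x) ≤ ∫ z, x ⬝ᵥ X z *ᵥ x ∂μ) {θ : ℝ} (hθ : 0 < θ) (S : ℕ)
    {A : Matrix n n ℝ} (hA : A.IsSymm) :
    ∫⁻ z, ENNReal.ofReal (NormedSpace.exp (A + -θ • ∑ s, X (z s))).trace
        ∂(Measure.pi fun _ : Fin S => μ) ≤
      ENNReal.ofReal (Real.exp (-((1 - Real.exp (-θ * c)) / c * l)) ^ S *
        (NormedSpace.exp A).trace) := by
  induction S generalizing A with
  | zero => simp
  | succ S ih =>
    have hmp := (measurePreserving_piFinSuccAbove (fun _ : Fin (S + 1) => μ) 0).symm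
    have hm : Measurable fun z : Fin (S + 1) → E =>
        ENNReal.ofReal (NormedSpace.exp (A + -θ • ∑ s, X (z s))).trace := by
      refine (measurable_trace_exp fun i j => ?_).ennreal_ofReal
      simp only [add_apply, smul_apply, sum_apply]
      exact ((Finset.measurable_fun_sum _ fun s _ =>
        (hmeas i j).comp (measurable_pi_apply s)).const_smul (-θ)).const_add _
    rw [← hmp.lintegral_comp hm]
    refine (lintegral_prod _ (hm.comp hmp.measurable).aemeasurable).trans_le ?_
    simp only [Function.comp_apply]
    have h1 : ∀ z : E, ∫⁻ y, ENNReal.ofReal (NormedSpace.exp (A + -θ • ∑ s,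
        X ((MeasurableEquiv.piFinSuccAbove (fun _ : Fin (S + 1) => E) 0).symm (z, y) s))).trace
          ∂(Measure.pi fun _ : Fin S => μ) ≤
        ENNReal.ofReal (Real.exp (-((1 - Real.exp (-θ * c)) / c * l)) ^ S) *
          ENNReal.ofReal (NormedSpace.exp (A + -θ • X z)).trace := fun z => by
      rw [← ENNReal.ofReal_mul (by positivity)]
      refine le_trans (le_of_eq ?_) (ih (hA.add ((hsymm z).smul (-θ))))
      congr 1
      funext y
      rw [Fin.sum_univ_succ, smul_add, ← add_assoc]
      rfl
    refine (lintegral_mono h1).trans ?_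
    rw [lintegral_const_mul' _ _ ENNReal.ofReal_ne_top]
    refine (mul_le_mul_right (lintegral_trace_exp_add_le hmeas hsymm hc hX hl hA hθ) _).trans_eq ?_
    rw [← ENNReal.ofReal_mul (by positivity), pow_succ, mul_assoc]

/-- Lower-tail matrix Chernoff bound for independent copies of a scaled random projection. -/
theorem exists_chernoff_bound (hmeas : ∀ i j, Measurable fun z => X z i j)
    (hsymm : ∀ z, (X z).IsSymm) (hc : 0 < c) (hX : ∀ z, X z * X z = c • X z)
    (hl : ∀ x, l * (x ⬝ᵥ x) ≤ ∫ z, x ⬝ᵥ X z *ᵥ x ∂μ) {δ : ℝ} (hδ : 0 < δ) (hδ' : δ < 1)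
    (S : ℕ) :
    ∃ B : Set (Fin S → E), MeasurableSet B ∧
      Measure.pi (fun _ : Fin S => μ) B ≤
        ENNReal.ofReal (Fintype.card n *
          Real.exp (-((δ + (1 - δ) * Real.log (1 - δ)) * (S * l / c)))) ∧
      ∀ z ∉ B, ∀ x, (1 - δ) * (S * l) * (x ⬝ᵥ x) ≤ x ⬝ᵥ (∑ s, X (z s)) *ᵥ x := by
  have hlog : Real.log (1 - δ) < 0 := Real.log_neg (by linarith) (by linarith)
  -- The optimal exponent, for which exp(−θc) = 1 − δ.
  set θ := -Real.log (1 - δ) / c with hθdef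
  have hθ : 0 < θ := div_pos (by linarith) hc
  have hθc : -θ * c = Real.log (1 - δ) := by rw [hθdef]; field_simp
  have hm : Measurable fun z : Fin S → E => (NormedSpace.exp (-θ • ∑ s, X (z s))).trace := by
    refine measurable_trace_exp fun i j => ?_
    simp only [smul_apply, sum_apply]
    exact (Finset.measurable_fun_sum _ fun s _ =>
      (hmeas i j).comp (measurable_pi_apply s)).const_smul (-θ)
  set b := Real.exp (-θ * ((1 - δ) * (S * l))) with hb
  have hb0 : 0 < b := Real.exp_pos _
  -- The exceptional set is the one to which Markov's inequality applies; it is measurable and does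
  -- not depend on x. Starting from A = 0 contributes trace 1 = card n.
  refine ⟨{z | ENNReal.ofReal b ≤
      ENNReal.ofReal (NormedSpace.exp (-θ • ∑ s, X (z s))).trace},
    measurableSet_le measurable_const hm.ennreal_ofReal, ?_, ?_⟩
  · have h1 := lintegral_pi_trace_exp_le (μ := μ) hmeas hsymm hc hX hl hθ S
      (A := 0) (by simp [IsSymm])
    have h2 := mul_meas_ge_le_lintegral (μ := Measure.pi fun _ : Fin S => μ)
      hm.ennreal_ofReal (ENNReal.ofReal b)
    simp only [zero_add] at h1
    have h3 := h2.trans h1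
    rw [mul_comm, ← ENNReal.le_div_iff_mul_le (Or.inl (by simpa using hb0))
      (Or.inl ENNReal.ofReal_ne_top), ← ENNReal.ofReal_div_of_pos hb0] at h3
    refine h3.trans_eq ?_
    congr 1
    rw [NormedSpace.exp_zero, trace_one, hθc, Real.exp_log (by linarith), ← Real.exp_nat_mul, hb,
      mul_comm (Real.exp _), mul_div_assoc, ← Real.exp_sub]
    congr 2
    rw [hθdef]
    field_simp
    ring
  · intro z hz x
    refine le_dotProduct_mulVec_of_trace_exp_lt ?_ hθ ?_ x
    · rw [IsSymm, transpose_sum]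
      exact Finset.sum_congr rfl fun s _ => hsymm _
    · rw [Set.mem_ofPred_eq, not_le] at hz
      exact (ENNReal.ofReal_lt_ofReal_iff_of_nonneg (trace_exp_nonneg (by
        refine IsSymm.smul ?_ _
        rw [IsSymm, transpose_sum]
        exact Finset.sum_congr rfl fun s _ => hsymm _))).1 hz

end Chernoff

end Matrix

/-! ### Zero sets of polynomials are null. -/

lemma MvPolynomial.ae_eval_ne_zero {d : ℕ} {p : MvPolynomial (Fin d) ℝ} (hp : p ≠ 0) :
    ∀ᵐ x : Fin d → ℝ, MvPolynomial.eval x p ≠ 0 := by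
  induction d with
  | zero =>
    refine Eventually.of_forall fun x hx => hp ?_
    rw [MvPolynomial.eq_C_of_isEmpty p] at hx ⊢
    simpa using hx
  | succ d ih =>
    -- View p as a polynomial in its first variable. By induction the leading coefficient is nonzero
    -- at almost every value of the others, where the slice of the zero set is finite; Fubini
    -- concludes.
    set q := MvPolynomial.finSuccEquiv ℝ d p with hq
    have hq0 : q ≠ 0 := by simpa [hq] using hp
    have hmp := volume_preserving_piFinSuccAbove (fun _ : Fin (d + 1) => ℝ) 0
    have hm : MeasurableSet {x : Fin (d + 1) → ℝ | MvPolynomial.eval x p = 0} :=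
      (MvPolynomial.continuous_eval p).measurable (measurableSet_singleton 0)
    rw [ae_iff]
    simp only [not_not]
    rw [← hmp.symm.measure_preimage hm.nullMeasurableSet, Measure.volume_eq_prod,
      Measure.prod_apply_symm (hmp.symm.measurable hm)]
    have h0 : ∀ᵐ s : Fin d → ℝ, volume ((fun y : ℝ => (y, s)) ⁻¹'
        ((MeasurableEquiv.piFinSuccAbove (fun _ : Fin (d + 1) => ℝ) 0).symm ⁻¹'
          {x | MvPolynomial.eval x p = 0})) = 0 := by
      filter_upwards [ih (p := q.leadingCoeff) (Polynomial.leadingCoeff_ne_zero.2 hq0)] with s hs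
      have hne : Polynomial.map (MvPolynomial.eval s) q ≠ 0 := fun h => hs (by
        have := congrArg (fun r => Polynomial.coeff r q.natDegree) h
        simpa [Polynomial.coeff_map] using this)
      refine (Set.Finite.subset (Polynomial.finite_setOfPred_isRoot hne) ?_).measure_zero _
      intro y hy
      have h2 : MvPolynomial.eval (Fin.cons y s : Fin (d + 1) → ℝ) p = 0 := by
        have h3 : (MeasurableEquiv.piFinSuccAbove (fun _ : Fin (d + 1) => ℝ) 0).symm (y, s) =
          (Fin.cons y s : Fin (d + 1) → ℝ) := by
          simp [MeasurableEquiv.piFinSuccAbove, Fin.insertNthEquiv]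
        rw [← h3]
        exact hy
      rw [MvPolynomial.eval_eq_eval_mv_eval'] at h2
      exact h2
    rw [lintegral_congr_ae h0]
    simp

/-! ### Truncation, and second moments of sample averages. -/

namespace CLS

lemma trunc_eq_max_min {L : ℝ} (hL : 0 ≤ L) (x : ℝ) : trunc L x = max (-L) (min x L) := by
  unfold trunc
  rcases lt_trichotomy x 0 with h | h | h
  · rw [Real.sign_of_neg h, abs_of_neg h, min_eq_left (by linarith : x ≤ L),
      show -1 * min (-x) L = -min (-x) L by ring, ← max_neg_neg, neg_neg, max_comm]
  · simp [h, hL]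
  · rw [Real.sign_of_pos h, abs_of_pos h, one_mul, max_eq_right]
    exact (neg_nonpos.2 hL).trans (le_min h.le hL)

lemma continuous_trunc {L : ℝ} (hL : 0 ≤ L) : Continuous (trunc L) := by
  rw [show trunc L = fun x => max (-L) (min x L) from funext (trunc_eq_max_min hL)]
  fun_prop

lemma abs_trunc_le {L : ℝ} (hL : 0 ≤ L) (x : ℝ) : |trunc L x| ≤ L := by
  rw [trunc_eq_max_min hL, abs_le]
  exact ⟨le_max_left _ _, max_le (by linarith) (min_le_right _ _)⟩

lemma abs_sub_trunc_le {L y : ℝ} (hy : |y| ≤ L) (x : ℝ) : |y - trunc L x| ≤ |y - x| := by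
  have hL : 0 ≤ L := (abs_nonneg y).trans hy
  obtain ⟨h1, h2⟩ := abs_le.1 hy
  rw [trunc_eq_max_min hL]
  rcases le_total x L with h | h
  · rw [min_eq_left h]
    rcases le_total (-L) x with h' | h'
    · rw [max_eq_right h']
    · rw [max_eq_left h', abs_of_nonneg (by linarith), abs_of_nonneg (by linarith)]
      linarith
  · rw [min_eq_right h, max_eq_right (by linarith), abs_of_nonpos (by linarith),
      abs_of_nonpos (by linarith)]
    linarith

open ProbabilityTheory in
/-- Second moment of an average of independent identically distributed variables. -/
lemma integral_sq_average_le {Ω E : Type*} [MeasurableSpace Ω] [MeasurableSpace E] {ρ : Measure Ω}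
    [IsProbabilityMeasure ρ] {μ : Measure E} {S : ℕ} (hS : S ≠ 0) {Z : Fin S → Ω → E}
    (hZ : ∀ s, Measurable (Z s)) (hind : iIndepFun Z ρ) (hlaw : ∀ s, Measure.map (Z s) ρ = μ)
    {Y : E → ℝ} (hY : MemLp Y 2 μ) :
    Integrable (fun ω => ((1 / (S : ℝ)) * ∑ s, Y (Z s ω)) ^ 2) ρ ∧
      ∫ ω, ((1 / (S : ℝ)) * ∑ s, Y (Z s ω)) ^ 2 ∂ρ ≤
        (1 / (S : ℝ)) * ∫ z, Y z ^ 2 ∂μ + (∫ z, Y z ∂μ) ^ 2 := by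
  have hmem : ∀ s, MemLp (fun ω => Y (Z s ω)) 2 ρ := fun s =>
    hY.comp_measurePreserving ⟨hZ s, hlaw s⟩
  have hTm : MemLp (∑ s, fun ω => Y (Z s ω)) 2 ρ := memLp_finsetSum' _ fun s _ => hmem s
  have hI : ∀ {F : E → ℝ}, AEStronglyMeasurable F μ → ∀ s, ∫ ω, F (Z s ω) ∂ρ = ∫ z, F z ∂μ :=
    fun {F} hF s => by
      rw [← hlaw s] at hF ⊢
      exact (integral_map (hZ s).aemeasurable hF).symm
  have hindY : iIndepFun (fun s ω => Y (Z s ω)) ρ :=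
    hind.comp₀ (fun _ => Y) (fun s => (hZ s).aemeasurable)
      (fun s => by rw [hlaw s]; exact hY.aestronglyMeasurable.aemeasurable)
  -- Variances of independent terms add, and each is at most the second moment.
  have hvar : variance (∑ s, fun ω => Y (Z s ω)) ρ ≤ S * ∫ z, Y z ^ 2 ∂μ := by
    rw [IndepFun.variance_sum (fun s _ => hmem s) fun i _ j _ hij => hindY.indepFun hij]
    calc _ ≤ ∑ s : Fin S, ∫ z, Y z ^ 2 ∂μ := by
          refine Finset.sum_le_sum fun s _ => ?_
          refine (variance_le_expectation_sq (hmem s).aestronglyMeasurable).trans_eq ?_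
          simp only [Pi.pow_apply]
          exact hI (F := fun z => Y z ^ 2) (hY.aestronglyMeasurable.pow 2) s
      _ = _ := by simp
  have hmean : ∫ ω, (∑ s, fun ω => Y (Z s ω)) ω ∂ρ = S * ∫ z, Y z ∂μ := by
    simp only [Finset.sum_apply]
    rw [integral_finsetSum _ fun s _ => (hmem s).integrable one_le_two]
    simp [hI hY.aestronglyMeasurable]
  have hsq := hTm.integrable_sq
  rw [variance_eq_sub hTm, hmean] at hvar
  simp only [Pi.pow_apply, Finset.sum_apply] at hvar hsq
  have hS' : (0 : ℝ) < S := by positivity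
  simp only [mul_pow]
  refine ⟨hsq.const_mul _, ?_⟩
  rw [integral_const_mul]
  calc _ ≤ (1 / (S : ℝ)) ^ 2 * (S * ∫ z, Y z ^ 2 ∂μ + (S * ∫ z, Y z ∂μ) ^ 2) := by
        gcongr
        linarith
    _ = _ := by field_simp

end CLS

/-! ### Christoffel weights and the random rank-one matrix. -/

namespace CLS

open Matrix

variable {d N : ℕ} {D : Set (Fin d → ℝ)} {w : (Fin d → ℝ) → ℝ}
  {φ : Fin N → MvPolynomial (Fin d) ℝ} {μ : Measure (Fin d → ℝ)} {v : (Fin d → ℝ) → ℝ}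

/-- The vector of values of the basis polynomials. -/
noncomputable def basisVec (φ : Fin N → MvPolynomial (Fin d) ℝ) (z : Fin d → ℝ) : Fin N → ℝ :=
  fun n => MvPolynomial.eval z (φ n)

/-- The Christoffel weight `N / K`. -/
noncomputable def christoffelWeight (φ : Fin N → MvPolynomial (Fin d) ℝ) (z : Fin d → ℝ) : ℝ :=
  (N : ℝ) / kernelDiag φ z

/-- The weighted rank-one matrix `(N / K) φ φᵀ`. -/
noncomputable def christoffelMatrix (φ : Fin N → MvPolynomial (Fin d) ℝ) (z : Fin d → ℝ) :
    Matrix (Fin N) (Fin N) ℝ :=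
  christoffelWeight φ z • vecMulVec (basisVec φ z) (basisVec φ z)

lemma measurable_basisVec (m : Fin N) : Measurable fun z => basisVec φ z m :=
  (MvPolynomial.continuous_eval (φ m)).measurable

lemma measurable_christoffelWeight : Measurable (christoffelWeight φ) :=
  measurable_const.div (Finset.measurable_fun_sum _ fun m _ => (measurable_basisVec m).pow_const 2)

lemma kernelDiag_eq (z : Fin d → ℝ) : kernelDiag φ z = basisVec φ z ⬝ᵥ basisVec φ z := by
  simp [kernelDiag, dotProduct, basisVec, sq]

lemma expansion_eq (c : Fin N → ℝ) (z : Fin d → ℝ) : expansion φ c z = c ⬝ᵥ basisVec φ z := rfl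

lemma measurable_expansion (c : Fin N → ℝ) : Measurable (expansion φ c) :=
  Finset.measurable_fun_sum _ fun m _ => (measurable_basisVec m).const_mul _

lemma kernelDiag_nonneg (z : Fin d → ℝ) : 0 ≤ kernelDiag φ z :=
  Finset.sum_nonneg fun _ _ => sq_nonneg _

lemma christoffelWeight_nonneg (z : Fin d → ℝ) : 0 ≤ christoffelWeight φ z :=
  div_nonneg N.cast_nonneg (kernelDiag_nonneg z)

lemma christoffelWeight_mul_kernelDiag_le (z : Fin d → ℝ) :
    christoffelWeight φ z * kernelDiag φ z ≤ N := by
  by_cases h : kernelDiag φ z = 0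
  · simp [h]
  · rw [christoffelWeight, div_mul_cancel₀ _ h]

lemma dotProduct_christoffelMatrix (z : Fin d → ℝ) (x : Fin N → ℝ) :
    x ⬝ᵥ christoffelMatrix φ z *ᵥ x = christoffelWeight φ z * expansion φ x z ^ 2 := by
  rw [christoffelMatrix, smul_mulVec, vecMulVec_mulVec, dotProduct_smul, expansion_eq,
    dotProduct_comm (basisVec φ z) x]
  simp only [dotProduct_smul, smul_eq_mul, MulOpposite.smul_eq_mul_unop,
    MulOpposite.unop_op]
  ring

lemma christoffelMatrix_isSymm (z : Fin d → ℝ) : (christoffelMatrix φ z).IsSymm := by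
  rw [christoffelMatrix]
  exact IsSymm.smul (transpose_vecMulVec _ _) _

/-- (φφᵀ)² = Kφφᵀ and (N/K)K = N. At common zeros of the basis, division by zero makes the weight 0,
so the identity holds everywhere. It permits the Chernoff bound with c = N. -/
lemma christoffelMatrix_mul_self (z : Fin d → ℝ) :
    christoffelMatrix φ z * christoffelMatrix φ z = (N : ℝ) • christoffelMatrix φ z := by
  rw [christoffelMatrix, smul_mul_smul_comm, vecMulVec_mul_vecMulVec, ← kernelDiag_eq]
  by_cases h : kernelDiag φ z = 0
  · simp [christoffelWeight, h]
  · have : kernelDiag φ z * christoffelWeight φ z = N := by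
      rw [christoffelWeight, mul_div_cancel₀ _ h]
    rw [vecMulVec_smul, smul_smul, smul_smul, mul_assoc,
      mul_comm (christoffelWeight φ z) (kernelDiag φ z), this, mul_comm]

lemma measurable_christoffelMatrix (i j : Fin N) :
    Measurable fun z => christoffelMatrix φ z i j := by
  simp only [christoffelMatrix, Matrix.smul_apply, vecMulVec_apply, smul_eq_mul]
  exact measurable_christoffelWeight.mul ((measurable_basisVec i).mul (measurable_basisVec j))

/-! ### Integration against the equilibrium measure -/

section Equilibrium

lemma eq_withDensity_restrict (hD : MeasurableSet D) (hμ : μ Dᶜ = 0)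
    (hv : μ = volume.withDensity fun z => ENNReal.ofReal (v z)) :
    μ = (volume.restrict D).withDensity fun z => ENNReal.ofReal (v z) := by
  rw [← restrict_withDensity hD, ← hv, Measure.restrict_eq_self_of_ae_mem]
  exact (ae_iff.2 hμ : ∀ᵐ z ∂μ, z ∈ D)

lemma integral_eq_setIntegral_mul (hv_meas : Measurable v) (hv_nonneg : ∀ z, 0 ≤ v z)
    (hv : μ = (volume.restrict D).withDensity fun z => ENNReal.ofReal (v z))
    (F : (Fin d → ℝ) → ℝ) : ∫ z, F z ∂μ = ∫ z in D, F z * v z := by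
  have h := integral_withDensity_eq_integral_smul (μ := volume.restrict D)
    (f := fun z => (v z).toNNReal) hv_meas.real_toNNReal F
  rw [hv]
  refine h.trans (integral_congr_ae (Eventually.of_forall fun z => ?_))
  simp [NNReal.smul_def, hv_nonneg z, mul_comm]

lemma integrable_iff_integrableOn_mul (hv_meas : Measurable v) (hv_nonneg : ∀ z, 0 ≤ v z)
    (hv : μ = (volume.restrict D).withDensity fun z => ENNReal.ofReal (v z))
    (F : (Fin d → ℝ) → ℝ) : Integrable F μ ↔ IntegrableOn (fun z => F z * v z) D := by
  have h := integrable_withDensity_iff_integrable_smul (μ := volume.restrict D)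
    (f := fun z => (v z).toNNReal) hv_meas.real_toNNReal (g := F)
  rw [hv]
  refine h.trans (integrable_congr (Eventually.of_forall fun z => ?_))
  simp [NNReal.smul_def, hv_nonneg z, mul_comm]

variable (hI : ∀ F : (Fin d → ℝ) → ℝ, ∫ z, F z ∂μ = ∫ z in D, F z * v z)
include hI

lemma wInner_effWeight (g h : (Fin d → ℝ) → ℝ) :
    wInner D (effWeight φ v) g h = ∫ z, christoffelWeight φ z * (g z * h z) ∂μ := by
  rw [hI, wInner]
  congr 1 with z
  simp only [effWeight, christoffelWeight]
  ring

lemma wNormSq_effWeight (g : (Fin d → ℝ) → ℝ) :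
    wNormSq D (effWeight φ v) g = ∫ z, christoffelWeight φ z * g z ^ 2 ∂μ := by
  rw [hI, wNormSq]
  congr 1 with z
  simp only [effWeight, christoffelWeight]
  ring

/-- R is the expectation of the random matrix under the sampling law, hence the target of the sample
Gramian. -/
lemma gramR_apply (i j : Fin N) : gramR D φ v i j = ∫ z, christoffelMatrix φ z i j ∂μ := by
  rw [gramR, wInner_effWeight hI]
  rfl

end Equilibrium
end CLS

/-! ### Weighted moments, expansions and projections. -/

namespace CLS

open Matrix

variable {d N : ℕ} {D : Set (Fin d → ℝ)} {w : (Fin d → ℝ) → ℝ}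
  {φ : Fin N → MvPolynomial (Fin d) ℝ} {μ : Measure (Fin d → ℝ)} {v : (Fin d → ℝ) → ℝ}

lemma exists_eval_eq_expansion {P : Submodule ℝ (MvPolynomial (Fin d) ℝ)}
    (hP : Submodule.span ℝ (Set.range φ) = P) {p : MvPolynomial (Fin d) ℝ} (hp : p ∈ P) :
    ∃ a : Fin N → ℝ, ∀ z, MvPolynomial.eval z p = expansion φ a z := by
  rw [← hP, Submodule.mem_span_range_iff_exists_fun] at hp
  obtain ⟨a, rfl⟩ := hp
  exact ⟨a, fun z => by simp [expansion, MvPolynomial.smul_eval]⟩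

lemma expansion_eq_eval (a : Fin N → ℝ) (z : Fin d → ℝ) :
    expansion φ a z = MvPolynomial.eval z (∑ n, a n • φ n) := by
  simp [expansion, MvPolynomial.smul_eval]

lemma continuous_expansion (a : Fin N → ℝ) : Continuous (expansion φ a) := by
  rw [funext (expansion_eq_eval a)]
  exact MvPolynomial.continuous_eval _

lemma expansion_sub (a b : Fin N → ℝ) (z : Fin d → ℝ) :
    expansion φ (a - b) z = expansion φ a z - expansion φ b z := by
  simp only [expansion_eq, sub_dotProduct]

lemma christoffelWeight_mul_expansion_sq_le (a : Fin N → ℝ) (z : Fin d → ℝ) :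
    christoffelWeight φ z * expansion φ a z ^ 2 ≤ N * (a ⬝ᵥ a) := by
  have h1 : expansion φ a z ^ 2 ≤ (a ⬝ᵥ a) * kernelDiag φ z := by
    have := Finset.sum_mul_sq_le_sq_mul_sq Finset.univ a (basisVec φ z)
    simpa [expansion, dotProduct, kernelDiag, basisVec, sq] using this
  have h2 : 0 ≤ a ⬝ᵥ a := Finset.sum_nonneg fun i _ => mul_self_nonneg _
  calc _ ≤ christoffelWeight φ z * ((a ⬝ᵥ a) * kernelDiag φ z) := by
        gcongr; exact christoffelWeight_nonneg z
    _ = (christoffelWeight φ z * kernelDiag φ z) * (a ⬝ᵥ a) := by ring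
    _ ≤ _ := by gcongr; exact christoffelWeight_mul_kernelDiag_le z

lemma integrable_christoffelWeight_mul_expansion_sq [IsProbabilityMeasure μ] (a : Fin N → ℝ) :
    Integrable (fun z => christoffelWeight φ z * expansion φ a z ^ 2) μ := by
  refine Integrable.of_bound (measurable_christoffelWeight.mul
    ((measurable_expansion a).pow_const 2)).aestronglyMeasurable (N * (a ⬝ᵥ a))
    (Eventually.of_forall fun z => ?_)
  rw [Real.norm_of_nonneg (mul_nonneg (christoffelWeight_nonneg z) (sq_nonneg _))]
  exact christoffelWeight_mul_expansion_sq_le a z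

lemma integrable_christoffelWeight_mul_sub_expansion_sq [IsProbabilityMeasure μ]
    {f : (Fin d → ℝ) → ℝ} (hf_meas : AEMeasurable f μ)
    (hf : Integrable (fun z => christoffelWeight φ z * f z ^ 2) μ) (a : Fin N → ℝ) :
    Integrable (fun z => christoffelWeight φ z * (f z - expansion φ a z) ^ 2) μ := by
  refine Integrable.mono' ((hf.const_mul 2).add
    ((integrable_christoffelWeight_mul_expansion_sq (φ := φ) a).const_mul 2)) ?_ ?_
  · exact (measurable_christoffelWeight.aemeasurable.mul
      ((hf_meas.sub (measurable_expansion a).aemeasurable).pow_const 2)).aestronglyMeasurable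
  · refine Eventually.of_forall fun z => ?_
    have hk := christoffelWeight_nonneg (φ := φ) z
    rw [Real.norm_of_nonneg (mul_nonneg hk (sq_nonneg _))]
    simp only [Pi.add_apply]
    nlinarith [mul_nonneg hk (sq_nonneg (f z + expansion φ a z))]

lemma christoffelWeight_mul_basisVec_sq_le (m : Fin N) (z : Fin d → ℝ) :
    christoffelWeight φ z * basisVec φ z m ^ 2 ≤ N := by
  refine le_trans ?_ (christoffelWeight_mul_kernelDiag_le (φ := φ) z)
  exact mul_le_mul_of_nonneg_left (Finset.single_le_sum
    (f := fun n => MvPolynomial.eval z (φ n) ^ 2) (fun _ _ => sq_nonneg _) (Finset.mem_univ m))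
    (christoffelWeight_nonneg z)

/-- The weighted moments of a square integrable function are square integrable. -/
lemma memLp_christoffelWeight_mul [IsProbabilityMeasure μ]
    {g : (Fin d → ℝ) → ℝ} (hg_meas : AEMeasurable g μ)
    (hg : Integrable (fun z => christoffelWeight φ z * g z ^ 2) μ) (m : Fin N) :
    MemLp (fun z => christoffelWeight φ z * (g z * basisVec φ z m)) 2 μ := by
  have hm : AEMeasurable (fun z => christoffelWeight φ z * (g z * basisVec φ z m)) μ :=
    measurable_christoffelWeight.aemeasurable.mul
      (hg_meas.mul (measurable_basisVec m).aemeasurable)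
  rw [memLp_two_iff_integrable_sq hm.aestronglyMeasurable]
  refine Integrable.mono' (hg.const_mul N) (hm.pow_const 2).aestronglyMeasurable
    (Eventually.of_forall fun z => ?_)
  have hk := mul_nonneg (christoffelWeight_nonneg (φ := φ) z) (sq_nonneg (g z))
  rw [Real.norm_of_nonneg (sq_nonneg _)]
  have := mul_le_mul_of_nonneg_right (christoffelWeight_mul_basisVec_sq_le (φ := φ) m z) hk
  linarith

/-- The squares of the φ_m sum to K, which the Christoffel weight cancels. Summing before estimating
gives the factor N instead of N². -/
lemma sum_integral_sq_le [IsProbabilityMeasure μ]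
    {g : (Fin d → ℝ) → ℝ} (hg_meas : AEMeasurable g μ)
    (hg : Integrable (fun z => christoffelWeight φ z * g z ^ 2) μ) :
    ∑ m, ∫ z, (christoffelWeight φ z * (g z * basisVec φ z m)) ^ 2 ∂μ ≤
      N * ∫ z, christoffelWeight φ z * g z ^ 2 ∂μ := by
  have hi := fun m => (memLp_christoffelWeight_mul hg_meas hg m).integrable_sq
  rw [← integral_finsetSum _ fun m _ => hi m, ← integral_const_mul]
  refine integral_mono (integrable_finsetSum _ fun m _ => hi m) (hg.const_mul _) fun z => ?_
  have hk := mul_nonneg (christoffelWeight_nonneg (φ := φ) z) (sq_nonneg (g z))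
  have h := mul_le_mul_of_nonneg_right (christoffelWeight_mul_kernelDiag_le (φ := φ) z) hk
  refine le_trans (le_of_eq ?_) h
  rw [kernelDiag, Finset.mul_sum, Finset.sum_mul]
  refine Finset.sum_congr rfl fun m _ => ?_
  simp only [basisVec]
  ring

/-! ### The weighted space on `D` -/

/-- Bounded almost everywhere measurable functions on `D`. -/
def IsBoundedMeasurableOn (D : Set (Fin d → ℝ)) (F : (Fin d → ℝ) → ℝ) : Prop :=
  AEStronglyMeasurable F (volume.restrict D) ∧ ∃ C, ∀ z ∈ D, |F z| ≤ C

namespace IsBoundedMeasurableOn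

variable {F G : (Fin d → ℝ) → ℝ}

lemma mul (hF : IsBoundedMeasurableOn D F) (hG : IsBoundedMeasurableOn D G) :
    IsBoundedMeasurableOn D fun z => F z * G z := by
  obtain ⟨hF, A, hA⟩ := hF
  obtain ⟨hG, B, hB⟩ := hG
  refine ⟨hF.mul hG, A * B, fun z hz => ?_⟩
  rw [abs_mul]
  exact mul_le_mul (hA z hz) (hB z hz) (abs_nonneg _) ((abs_nonneg _).trans (hA z hz))

lemma sub (hF : IsBoundedMeasurableOn D F) (hG : IsBoundedMeasurableOn D G) :
    IsBoundedMeasurableOn D fun z => F z - G z := by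
  obtain ⟨hF, A, hA⟩ := hF
  obtain ⟨hG, B, hB⟩ := hG
  exact ⟨hF.sub hG, A + B, fun z hz => (abs_sub _ _).trans (add_le_add (hA z hz) (hB z hz))⟩

lemma sq (hF : IsBoundedMeasurableOn D F) : IsBoundedMeasurableOn D fun z => F z ^ 2 := by
  simpa only [pow_two] using hF.mul hF

lemma of_continuous (hD : IsCompact D) (hF : Continuous F) : IsBoundedMeasurableOn D F :=
  ⟨hF.aestronglyMeasurable, hD.exists_bound_of_continuousOn hF.continuousOn⟩

lemma integrableOn_mul (hD : MeasurableSet D) (hw : IntegrableOn w D)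
    (hF : IsBoundedMeasurableOn D F) : IntegrableOn (fun z => F z * w z) D := by
  obtain ⟨hF, C, hC⟩ := hF
  exact hw.bdd_mul hF (ae_restrict_of_forall_mem hD hC)

end IsBoundedMeasurableOn

lemma BoundedAdmissible.integrableOn_weight (hDw : BoundedAdmissible D w) : IntegrableOn w D := by
  simpa using hDw.integrableOn 1

lemma BoundedAdmissible.measurableSet (hDw : BoundedAdmissible D w) : MeasurableSet D :=
  hDw.isCompact.isClosed.measurableSet

lemma wInner_expansion (hDw : BoundedAdmissible D w) (hφ : IsOrthonormal D w φ)
    (a b : Fin N → ℝ) : wInner D w (expansion φ a) (expansion φ b) = a ⬝ᵥ b := by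
  have hint : ∀ m n, IntegrableOn (fun z =>
      a m * b n * (MvPolynomial.eval z (φ m) * MvPolynomial.eval z (φ n) * w z)) D := fun m n =>
    (((IsBoundedMeasurableOn.of_continuous hDw.isCompact (MvPolynomial.continuous_eval (φ m))).mul
      (IsBoundedMeasurableOn.of_continuous hDw.isCompact
        (MvPolynomial.continuous_eval (φ n)))).integrableOn_mul hDw.measurableSet
        hDw.integrableOn_weight).const_mul _
  have h : wInner D w (expansion φ a) (expansion φ b) =
      ∫ z in D, ∑ m, ∑ n,
        a m * b n * (MvPolynomial.eval z (φ m) * MvPolynomial.eval z (φ n) * w z) := by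
    unfold wInner
    congr 1 with z
    simp only [expansion, Finset.sum_mul, Finset.mul_sum]
    rw [Finset.sum_comm]
    exact Finset.sum_congr rfl fun m _ => Finset.sum_congr rfl fun n _ => by ring
  rw [h, integral_finsetSum _ fun m _ => integrable_finsetSum _ fun n _ => hint m n]
  refine Finset.sum_congr rfl fun m _ => ?_
  rw [integral_finsetSum _ fun n _ => hint m n]
  have h2 : ∀ n, ∫ z in D, MvPolynomial.eval z (φ m) * MvPolynomial.eval z (φ n) * w z =
      if m = n then 1 else 0 := hφ m
  simp [integral_const_mul, h2]

lemma wNormSq_expansion (hDw : BoundedAdmissible D w) (hφ : IsOrthonormal D w φ)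
    (a : Fin N → ℝ) : wNormSq D w (expansion φ a) = a ⬝ᵥ a := by
  rw [← wInner_expansion hDw hφ]
  simp only [wNormSq, wInner, sq]

/-- Pythagoras for the projection with coefficient vector `a`. -/
lemma wNormSq_sub_expansion (hDw : BoundedAdmissible D w) (hφ : IsOrthonormal D w φ)
    {f : (Fin d → ℝ) → ℝ} (hf : IsBoundedMeasurableOn D f) {a : Fin N → ℝ}
    (ha : ∀ b, wInner D w (fun z => f z - expansion φ a z) (expansion φ b) = 0) (c : Fin N → ℝ) :
    wNormSq D w (fun z => f z - expansion φ c z) =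
      wNormSq D w (fun z => f z - expansion φ a z) + (c - a) ⬝ᵥ (c - a) := by
  have hp : ∀ b : Fin N → ℝ, IsBoundedMeasurableOn D (expansion φ b) := fun b =>
    .of_continuous hDw.isCompact (continuous_expansion b)
  have hg := hf.sub (hp a)
  have i1 := hg.sq.integrableOn_mul hDw.measurableSet hDw.integrableOn_weight
  have i2 := (hg.mul (hp (c - a))).integrableOn_mul hDw.measurableSet hDw.integrableOn_weight
  have i3 := (hp (c - a)).sq.integrableOn_mul hDw.measurableSet hDw.integrableOn_weight
  have h0 := ha (c - a)
  rw [← wNormSq_expansion hDw hφ]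
  unfold wNormSq wInner at *
  calc _ = ∫ z in D, ((f z - expansion φ a z) ^ 2 * w z -
        2 * ((f z - expansion φ a z) * expansion φ (c - a) z * w z) +
        expansion φ (c - a) z ^ 2 * w z) := by
        congr 1 with z
        rw [expansion_sub]
        ring
    _ = _ := by
        refine (integral_add (i1.sub (i2.const_mul 2)) i3).trans ?_
        congr 1
        refine (integral_sub i1 (i2.const_mul 2)).trans ?_
        rw [integral_const_mul, h0, mul_zero, sub_zero]

section Truncation

variable {f : (Fin d → ℝ) → ℝ} {L : ℝ}

lemma wNormSq_sub_trunc_le (hDw : BoundedAdmissible D w)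
    (hf : AEStronglyMeasurable f (volume.restrict D)) (hfL : ∀ z ∈ D, |f z| ≤ L) (hL : 0 ≤ L)
    (c : Fin N → ℝ) :
    wNormSq D w (fun z => f z - trunc L (expansion φ c z)) ≤
      wNormSq D w (fun z => f z - expansion φ c z) := by
  have hp : IsBoundedMeasurableOn D (expansion φ c) :=
    .of_continuous hDw.isCompact (continuous_expansion c)
  have ht : IsBoundedMeasurableOn D fun z => trunc L (expansion φ c z) :=
    .of_continuous hDw.isCompact ((continuous_trunc hL).comp (continuous_expansion c))
  have hf' : IsBoundedMeasurableOn D f := ⟨hf, L, hfL⟩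
  refine setIntegral_mono_on
    ((hf'.sub ht).sq.integrableOn_mul hDw.measurableSet hDw.integrableOn_weight)
    ((hf'.sub hp).sq.integrableOn_mul hDw.measurableSet hDw.integrableOn_weight)
    hDw.measurableSet fun z hz => ?_
  exact mul_le_mul_of_nonneg_right (sq_le_sq.2 (abs_sub_trunc_le (hfL z hz) _)) (hDw.nonneg z hz)

lemma sq_sub_trunc_mul_le (hDw : BoundedAdmissible D w) (hfL : ∀ z ∈ D, |f z| ≤ L) (hL : 0 ≤ L)
    {z : Fin d → ℝ} (hz : z ∈ D) (x : ℝ) :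
    (f z - trunc L x) ^ 2 * w z ≤ 4 * L ^ 2 * w z := by
  refine mul_le_mul_of_nonneg_right ?_ (hDw.nonneg z hz)
  have h : |f z - trunc L x| ≤ 2 * L :=
    (abs_sub _ _).trans (by linarith [hfL z hz, abs_trunc_le hL x])
  calc (f z - trunc L x) ^ 2 = |f z - trunc L x| ^ 2 := (sq_abs _).symm
    _ ≤ (2 * L) ^ 2 := by gcongr
    _ = _ := by ring

lemma wNormSq_sub_trunc_le_const (hDw : BoundedAdmissible D w) (hw : ∫ z in D, w z = 1)
    (hf : AEStronglyMeasurable f (volume.restrict D)) (hfL : ∀ z ∈ D, |f z| ≤ L) (hL : 0 ≤ L)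
    (c : Fin N → ℝ) :
    wNormSq D w (fun z => f z - trunc L (expansion φ c z)) ≤ 4 * L ^ 2 := by
  have ht : IsBoundedMeasurableOn D fun z => trunc L (expansion φ c z) :=
    .of_continuous hDw.isCompact ((continuous_trunc hL).comp (continuous_expansion c))
  have hf' : IsBoundedMeasurableOn D f := ⟨hf, L, hfL⟩
  calc _ ≤ ∫ z in D, 4 * L ^ 2 * w z := setIntegral_mono_on
        ((hf'.sub ht).sq.integrableOn_mul hDw.measurableSet hDw.integrableOn_weight)
        (hDw.integrableOn_weight.const_mul _) hDw.measurableSet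
        fun z hz => sq_sub_trunc_mul_le hDw hfL hL hz _
    _ = _ := by rw [integral_const_mul, hw, mul_one]

lemma wNormSq_nonneg (hDw : BoundedAdmissible D w) (g : (Fin d → ℝ) → ℝ) : 0 ≤ wNormSq D w g :=
  setIntegral_nonneg hDw.measurableSet fun z hz => mul_nonneg (sq_nonneg _) (hDw.nonneg z hz)

lemma continuous_wNormSq_sub_trunc (hDw : BoundedAdmissible D w)
    (hf : AEStronglyMeasurable f (volume.restrict D)) (hfL : ∀ z ∈ D, |f z| ≤ L) (hL : 0 ≤ L) :
    Continuous fun c : Fin N → ℝ =>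
      wNormSq D w (fun z => f z - trunc L (expansion φ c z)) := by
  refine continuous_of_dominated (bound := fun z => 4 * L ^ 2 * w z) (fun c => ?_) (fun c => ?_)
    (hDw.integrableOn_weight.const_mul _) (Eventually.of_forall fun z => ?_)
  · exact ((hf.sub ((continuous_trunc hL).comp
      (continuous_expansion c)).aestronglyMeasurable).pow 2).mul
      hDw.integrableOn_weight.aestronglyMeasurable
  · refine ae_restrict_of_forall_mem hDw.measurableSet fun z hz => ?_
    rw [Real.norm_of_nonneg (mul_nonneg (sq_nonneg _) (hDw.nonneg z hz))]
    exact sq_sub_trunc_mul_le hDw hfL hL hz _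
  · have h : Continuous fun c : Fin N → ℝ => expansion φ c z :=
      continuous_finsetSum _ fun n _ => (continuous_apply n).mul continuous_const
    exact ((continuous_const.sub ((continuous_trunc hL).comp h)).pow 2).mul continuous_const

end Truncation

/-! ### Positive definiteness of the Gramian -/

/-- A nonzero polynomial vanishes only on a Lebesgue null set, hence on a μ-null set. Applied to one
basis element this makes the weight positive almost everywhere, and applied to the expansion it
excludes a zero integral. -/
lemma expansion_sq_pos_of_ne_zero [IsProbabilityMeasure μ] (hN : 0 < N)
    (hDw : BoundedAdmissible D w) (hφ : IsOrthonormal D w φ) (hμ : μ ≪ volume)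
    {x : Fin N → ℝ} (hx : x ≠ 0) :
    0 < ∫ z, christoffelWeight φ z * expansion φ x z ^ 2 ∂μ := by
  have hp : ∑ n, x n • φ n ≠ 0 := fun h => hx (by
    rw [← dotProduct_self_eq_zero, ← wNormSq_expansion hDw hφ]
    simp [wNormSq, funext (expansion_eq_eval (φ := φ) x), h])
  have hφ0 : φ ⟨0, hN⟩ ≠ 0 := fun h => by
    have := hφ ⟨0, hN⟩ ⟨0, hN⟩
    simp [wInner, h] at this
  refine (integral_nonneg fun z => mul_nonneg (christoffelWeight_nonneg z)
    (sq_nonneg _)).lt_of_ne' fun h0 => ?_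
  rw [integral_eq_zero_iff_of_nonneg (fun z => mul_nonneg (christoffelWeight_nonneg z)
    (sq_nonneg _)) (integrable_christoffelWeight_mul_expansion_sq x)] at h0
  have hfalse : ∀ᵐ z ∂μ, False := by
    filter_upwards [h0, hμ.ae_le (MvPolynomial.ae_eval_ne_zero hp),
      hμ.ae_le (MvPolynomial.ae_eval_ne_zero hφ0)] with z h1 h2 h3
    rw [← expansion_eq_eval] at h2
    have hK : 0 < kernelDiag φ z := Finset.sum_pos' (fun _ _ => sq_nonneg _)
      ⟨⟨0, hN⟩, Finset.mem_univ _, by positivity⟩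
    have hk : 0 < christoffelWeight φ z := div_pos (by exact_mod_cast hN) hK
    simp only [Pi.zero_apply] at h1
    have : 0 < christoffelWeight φ z * expansion φ x z ^ 2 := by positivity
    exact this.ne' h1
  exact hfalse.exists.choose_spec

end CLS

/-! ### Consequences of the sampling condition. -/

namespace CLS

open Matrix

section Numerics

variable {δ r l : ℝ} {N S : ℕ}

lemma cDelta_pos (hδ : 0 < δ) (hδ' : δ ≤ 1 / 2) : 0 < cDelta δ := by
  have hx : 0 < 1 - δ := by linarith
  have h := Real.log_lt_sub_one_of_pos (inv_pos.2 hx) (by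
    intro h; rw [inv_eq_one] at h; linarith)
  rw [Real.log_inv] at h
  have h2 := mul_lt_mul_of_pos_left h hx
  rw [mul_sub, mul_inv_cancel₀ hx.ne'] at h2
  unfold cDelta
  linarith

/-- The chord of the convex function x log x over [1/2, 1] gives c_δ ≤ δ(1 − log 2). Four times the
resulting bound is the numerator 2 − 2 log 2 of ε(S). -/
lemma cDelta_le (hδ : 0 < δ) (hδ' : δ ≤ 1 / 2) : cDelta δ ≤ (1 - Real.log 2) / 2 := by
  have h := Real.convexOn_mul_log.2 (Set.mem_Ici.2 (by norm_num : (0 : ℝ) ≤ 1 / 2))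
    (Set.mem_Ici.2 zero_le_one) (by linarith : 0 ≤ 2 * δ) (by linarith : 0 ≤ 1 - 2 * δ) (by ring)
  simp only [smul_eq_mul, Real.log_one, mul_zero, add_zero, one_div, Real.log_inv] at h
  rw [show 2 * δ * 2⁻¹ + (1 - 2 * δ) * 1 = 1 - δ by ring] at h
  have hl := Real.log_two_lt_d9
  unfold cDelta
  nlinarith

variable (hN : 0 < N) (hr : 0 < r) (hδ : 0 < δ) (hδ' : δ ≤ 1 / 2) (hl : 0 < l)
  (hS : (S : ℝ) / (N * Real.log S) ≥ (1 + r) / cDelta δ * (1 / l))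
include hN hr hδ hδ' hl hS

omit hN in
lemma two_le_of_sampling : 2 ≤ S := by
  by_contra h
  have hc := cDelta_pos hδ hδ'
  have hpos : 0 < (1 + r) / cDelta δ * (1 / l) := by positivity
  -- In both cases log S is 0 in Lean, so the sampling ratio is 0 and cannot exceed a positive
  -- number.
  have : S = 0 ∨ S = 1 := by omega
  rcases this with rfl | rfl <;> simp at hS <;> simp at hpos <;> linarith

lemma log_mul_le_of_sampling :
    (1 + r) * Real.log S ≤ cDelta δ * (S * l / N) := by
  have h2 := two_le_of_sampling hr hδ hδ' hl hS
  have hc := cDelta_pos hδ hδ'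
  have hlog : 0 < Real.log S := Real.log_pos (by exact_mod_cast h2)
  have hN' : (0 : ℝ) < N := by exact_mod_cast hN
  rw [ge_iff_le, div_mul_div_comm, mul_one, div_le_div_iff₀ (by positivity) (by positivity)] at hS
  rw [← mul_div_assoc, le_div_iff₀ hN']
  linarith

lemma natCast_le_of_sampling (hl1 : l ≤ 1) : (N : ℝ) ≤ S := by
  have h2 := two_le_of_sampling hr hδ hδ' hl hS
  have h3 := log_mul_le_of_sampling hN hr hδ hδ' hl hS
  have hc := cDelta_pos hδ hδ'
  have hc2 := cDelta_le hδ hδ'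
  have hN' : (0 : ℝ) < N := by exact_mod_cast hN
  have hlog2 := Real.log_two_gt_d9
  have hlog : Real.log 2 ≤ Real.log S := Real.log_le_log (by norm_num) (by exact_mod_cast h2)
  have hs : (0 : ℝ) ≤ S / N := by positivity
  have h4 : cDelta δ * (S * l / N) ≤ 1 / 2 * (S / N) := by
    rw [mul_div_right_comm]
    have : cDelta δ ≤ 1 / 2 := by linarith
    have : (S / N : ℝ) * l ≤ S / N := mul_le_of_le_one_right hs hl1
    gcongr
  have h5 : 0.69 ≤ (1 + r) * Real.log S := by nlinarith
  have h6 : 1 ≤ (S / N : ℝ) := by linarith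
  rwa [one_le_div hN'] at h6

/-- The exponential is at most S^(−1−r); the spare factor 1/S pays for the dimension because N ≤ S.
-/
lemma mul_exp_le_of_sampling (hl1 : l ≤ 1) :
    N * Real.exp (-(cDelta δ * (S * l / N))) ≤ 1 / (S : ℝ) ^ r := by
  have h2 := two_le_of_sampling hr hδ hδ' hl hS
  have hS0 : (0 : ℝ) < S := by positivity
  calc _ ≤ (S : ℝ) * Real.exp (-((1 + r) * Real.log S)) := by
        exact mul_le_mul (natCast_le_of_sampling hN hr hδ hδ' hl hS hl1)
          (Real.exp_le_exp.2 (neg_le_neg (log_mul_le_of_sampling hN hr hδ hδ' hl hS)))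
          (Real.exp_pos _).le hS0.le
    _ = _ := by
        rw [show -((1 + r) * Real.log S) = Real.log S * (-1 - r) by ring,
          ← Real.rpow_def_of_pos hS0, Real.rpow_sub hS0, Real.rpow_neg_one]
        field_simp

lemma four_div_le_epsS : 4 / l ^ 2 * (N / S) ≤ epsS r S / l := by
  have h2 := two_le_of_sampling hr hδ hδ' hl hS
  have h3 := log_mul_le_of_sampling hN hr hδ hδ' hl hS
  have hc2 := cDelta_le hδ hδ'
  have hN' : (0 : ℝ) < N := by exact_mod_cast hN
  have hS0 : (0 : ℝ) < S := by positivity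
  have hlog : 0 < Real.log S := Real.log_pos (by exact_mod_cast h2)
  have h4 : (1 + r) * Real.log S ≤ (1 - Real.log 2) / 2 * (S * l / N) :=
    h3.trans (by gcongr)
  rw [show 4 / l ^ 2 * (N / S : ℝ) = (4 * (N / (S * l))) / l by field_simp]
  unfold epsS
  gcongr
  rw [le_div_iff₀ (by positivity)]
  calc 4 * (N / (S * l)) * ((1 + r) * Real.log S)
      ≤ 4 * (N / (S * l)) * ((1 - Real.log 2) / 2 * (S * l / N)) := by gcongr
    _ = 2 - 2 * Real.log 2 := by field_simp; ring

end Numerics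

lemma tendsto_epsS {r : ℝ} (hr : 0 < r) : Tendsto (epsS r) atTop (𝓝 0) := by
  refine Tendsto.const_div_atTop ?_ _
  exact (Real.tendsto_log_atTop.comp tendsto_natCast_atTop_atTop).const_mul_atTop (by linarith)

/-! ### Stability of least squares and the Gramian. -/

variable {d N S : ℕ} {D : Set (Fin d → ℝ)} {w : (Fin d → ℝ) → ℝ}
  {φ : Fin N → MvPolynomial (Fin d) ℝ} {μ : Measure (Fin d → ℝ)} {v : (Fin d → ℝ) → ℝ}

lemma dotProduct_sum_christoffelMatrix (z : Fin S → Fin d → ℝ) (x : Fin N → ℝ) :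
    x ⬝ᵥ (∑ s, christoffelMatrix φ (z s)) *ᵥ x =
      ∑ s, christoffelWeight φ (z s) * expansion φ x (z s) ^ 2 := by
  rw [sum_mulVec, dotProduct_sum]
  simp only [dotProduct_christoffelMatrix]

/-- The empirical moments of `g`. -/
noncomputable def empiricalMoment (φ : Fin N → MvPolynomial (Fin d) ℝ) (g : (Fin d → ℝ) → ℝ)
    (z : Fin S → Fin d → ℝ) : Fin N → ℝ :=
  fun m => (1 / (S : ℝ)) * ∑ s, christoffelWeight φ (z s) * (g (z s) * basisVec φ (z s) m)

lemma empiricalMoment_dotProduct (g : (Fin d → ℝ) → ℝ) (z : Fin S → Fin d → ℝ) (x : Fin N → ℝ) :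
    empiricalMoment φ g z ⬝ᵥ x =
      (1 / (S : ℝ)) * ∑ s, christoffelWeight φ (z s) * (g (z s) * expansion φ x (z s)) := by
  simp only [empiricalMoment, dotProduct, expansion, basisVec, Finset.mul_sum, Finset.sum_mul]
  rw [Finset.sum_comm]
  exact Finset.sum_congr rfl fun s _ => Finset.sum_congr rfl fun m _ => by ring

lemma eq_zero_of_forall_quadratic_nonneg {A B : ℝ} (hA : 0 ≤ A)
    (h : ∀ t : ℝ, 0 ≤ 2 * t * B + t ^ 2 * A) : B = 0 := by
  -- Using A + 1 in place of the minimizing denominator A also covers A = 0.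
  have h1 := h (-B / (A + 1))
  have h2 : 2 * (-B / (A + 1)) * B + (-B / (A + 1)) ^ 2 * A = -(B ^ 2 * (A + 2)) / (A + 1) ^ 2 := by
    field_simp
    ring
  rw [h2, div_nonneg_iff] at h1
  have h3 : 0 < (A + 1) ^ 2 := by positivity
  have h4 : B ^ 2 * (A + 2) ≤ 0 := by
    rcases h1 with h1 | h1
    · linarith [h1.1]
    · linarith [h1.2]
  have h5 : B ^ 2 ≤ 0 := by nlinarith [sq_nonneg B]
  exact pow_eq_zero_iff two_ne_zero |>.1 (le_antisymm h5 (sq_nonneg B))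

/-- The normal equations, tested in the direction of the error. -/
lemma IsCLSSolution.energy_eq {f : (Fin d → ℝ) → ℝ} {z : Fin S → Fin d → ℝ} {c : Fin N → ℝ}
    (hc : IsCLSSolution φ f z c) (a : Fin N → ℝ) :
    (1 / (S : ℝ)) * ∑ s, christoffelWeight φ (z s) * expansion φ (c - a) (z s) ^ 2 =
      empiricalMoment φ (fun z => f z - expansion φ a z) z ⬝ᵥ (c - a) := by
  set A := (1 / (S : ℝ)) * ∑ s, christoffelWeight φ (z s) * expansion φ (c - a) (z s) ^ 2 with hA
  set B := (1 / (S : ℝ)) * ∑ s, christoffelWeight φ (z s) *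
    ((f (z s) - expansion φ c (z s)) * expansion φ (c - a) (z s)) with hB
  have hA0 : 0 ≤ A := mul_nonneg (by positivity) (Finset.sum_nonneg fun s _ =>
    mul_nonneg (christoffelWeight_nonneg _) (sq_nonneg _))
  have hB0 : B = 0 := by
    -- Moving the minimizer along c − a changes the cost by a quadratic in t without constant term;
    -- minimality forces its linear coefficient to vanish.
    refine eq_zero_of_forall_quadratic_nonneg hA0 fun t => ?_
    have h := hc (c - t • (c - a))
    have h2 : clsCost φ f z (c - t • (c - a)) = clsCost φ f z c + (2 * t * B + t ^ 2 * A) := by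
      rw [hA, hB]
      simp only [clsCost, Finset.mul_sum, ← Finset.sum_add_distrib]
      refine Finset.sum_congr rfl fun s _ => ?_
      have h3 : expansion φ (c - t • (c - a)) (z s) =
          expansion φ c (z s) - t * expansion φ (c - a) (z s) := by
        rw [expansion_sub, expansion_eq (t • (c - a)), smul_dotProduct]
        rfl
      rw [h3, christoffelWeight]
      ring
    linarith
  rw [empiricalMoment_dotProduct, ← sub_eq_zero, ← neg_eq_zero, ← hB0, hA, hB, ← mul_sub,
    ← Finset.sum_sub_distrib, ← mul_neg, ← Finset.sum_neg_distrib]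
  congr 1
  refine Finset.sum_congr rfl fun s _ => ?_
  rw [expansion_sub]
  ring

/-- Stability of the least-squares solution for a well-conditioned sample. -/
lemma IsCLSSolution.error_le {f : (Fin d → ℝ) → ℝ} {z : Fin S → Fin d → ℝ} {c : Fin N → ℝ}
    (hc : IsCLSSolution φ f z c) (hS : S ≠ 0) {δ l : ℝ} (hδ' : δ ≤ 1 / 2) (hl : 0 < l)
    (hz : ∀ x : Fin N → ℝ, (1 - δ) * (S * l) * (x ⬝ᵥ x) ≤
      x ⬝ᵥ (∑ s, christoffelMatrix φ (z s)) *ᵥ x) (a : Fin N → ℝ) :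
    (c - a) ⬝ᵥ (c - a) ≤
      4 / l ^ 2 * ∑ m, empiricalMoment φ (fun z => f z - expansion φ a z) z m ^ 2 := by
  have h1 := hc.energy_eq a
  have h2 := hz (c - a)
  rw [dotProduct_sum_christoffelMatrix] at h2
  set h := empiricalMoment φ (fun z => f z - expansion φ a z) z
  have hcs : (h ⬝ᵥ (c - a)) ^ 2 ≤ (∑ m, h m ^ 2) * ((c - a) ⬝ᵥ (c - a)) := by
    have := Finset.sum_mul_sq_le_sq_mul_sq Finset.univ h (c - a)
    simpa [dotProduct, sq] using this
  have hq : 0 ≤ (c - a) ⬝ᵥ (c - a) := Finset.sum_nonneg fun i _ => mul_self_nonneg _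
  set q := (c - a) ⬝ᵥ (c - a)
  set H := ∑ m, h m ^ 2
  have hS0 : (0 : ℝ) < S := by positivity
  -- Here 1 − δ ≥ 1/2 is used. With Cauchy–Schwarz this gives (lq/2)² ≤ Hq, and dividing by q
  -- produces 4/l².
  have h3 : l / 2 * q ≤ h ⬝ᵥ (c - a) := by
    rw [← h1, one_div, ← div_eq_inv_mul, le_div_iff₀ hS0]
    refine le_trans ?_ h2
    have : 0 ≤ S * l * q := by positivity
    nlinarith
  have h4 : (l / 2 * q) ^ 2 ≤ H * q := (pow_le_pow_left₀ (by positivity) h3 2).trans hcs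
  rcases hq.eq_or_lt with h0 | h0
  · rw [← h0]; positivity
  · have h5 : (l / 2) ^ 2 * q ≤ H := by
      refine le_of_mul_le_mul_right ?_ h0
      linarith
    rw [div_mul_eq_mul_div, le_div_iff₀ (by positivity)]
    linarith

section Gram

variable [IsProbabilityMeasure μ]

lemma integrable_christoffelMatrix (hN : 0 < N) (i j : Fin N) :
    Integrable (fun z => christoffelMatrix φ z i j) μ :=
  integrable_apply_of_mul_self_eq_smul measurable_christoffelMatrix christoffelMatrix_isSymm
    (c := N) (by exact_mod_cast hN) christoffelMatrix_mul_self i j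

variable (hI : ∀ F : (Fin d → ℝ) → ℝ, ∫ z, F z ∂μ = ∫ z in D, F z * v z) (hN : 0 < N)
include hI

omit [IsProbabilityMeasure μ] in
lemma gramR_eq : gramR D φ v = Matrix.of fun i j => ∫ z, christoffelMatrix φ z i j ∂μ := by
  ext i j
  exact gramR_apply hI i j

omit [IsProbabilityMeasure μ] in
lemma gramR_isSymm : (gramR D φ v).IsSymm := by
  ext i j
  rw [transpose_apply, gramR_apply hI, gramR_apply hI]
  simp only [(christoffelMatrix_isSymm _).apply]

include hN

lemma dotProduct_gramR (x : Fin N → ℝ) :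
    x ⬝ᵥ gramR D φ v *ᵥ x = ∫ z, christoffelWeight φ z * expansion φ x z ^ 2 ∂μ := by
  rw [gramR_eq hI, ← integral_dotProduct_mulVec (integrable_christoffelMatrix hN)]
  simp only [dotProduct_christoffelMatrix]

lemma gramR_mulVec (y : Fin N → ℝ) (m : Fin N) :
    (gramR D φ v *ᵥ y) m =
      ∫ z, christoffelWeight φ z * (expansion φ y z * basisVec φ z m) ∂μ := by
  simp only [mulVec, dotProduct, gramR_apply hI]
  simp only [← integral_mul_const]
  rw [← integral_finsetSum _ fun n _ => (integrable_christoffelMatrix hN m n).mul_const _]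
  congr 1 with z
  simp only [expansion, Finset.sum_mul, Finset.mul_sum]
  refine Finset.sum_congr rfl fun n _ => ?_
  simp only [christoffelMatrix, Matrix.smul_apply, vecMulVec_apply, smul_eq_mul, basisVec]
  ring

lemma lambdaMin_mul_le (x : Fin N → ℝ) :
    lambdaMin (gramR D φ v) * (x ⬝ᵥ x) ≤ ∫ z, x ⬝ᵥ christoffelMatrix φ z *ᵥ x ∂μ := by
  have : Nonempty (Fin N) := ⟨⟨0, hN⟩⟩
  simp only [dotProduct_christoffelMatrix]
  rw [← dotProduct_gramR hI hN]
  exact sInf_spectrum_mul_le (gramR_isSymm hI) x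

/-- The least eigenvalue is at most each diagonal entry, and the trace of R is the expectation of
(N/K)K ≤ N. -/
lemma lambdaMin_le_one : lambdaMin (gramR D φ v) ≤ 1 := by
  have h : ∀ i, lambdaMin (gramR D φ v) ≤ ∫ z, christoffelMatrix φ z i i ∂μ := fun i => by
    simpa using lambdaMin_mul_le (μ := μ) hI hN (Pi.single i 1)
  have h2 := Finset.sum_le_sum fun i (_ : i ∈ Finset.univ) => h i
  rw [← integral_finsetSum _ fun i _ => integrable_christoffelMatrix hN i i] at h2
  have h3 : ∫ z, ∑ i, christoffelMatrix φ z i i ∂μ ≤ ∫ _, (N : ℝ) ∂μ := by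
    refine integral_mono (integrable_finsetSum _ fun i _ => integrable_christoffelMatrix hN i i)
      (integrable_const _) fun z => ?_
    refine le_trans (le_of_eq ?_) (christoffelWeight_mul_kernelDiag_le (φ := φ) z)
    rw [kernelDiag, Finset.mul_sum]
    refine Finset.sum_congr rfl fun i _ => ?_
    simp only [christoffelMatrix, Matrix.smul_apply, vecMulVec_apply, smul_eq_mul, basisVec, sq]
  have h4 := h2.trans h3
  have hN' : (0 : ℝ) < N := by exact_mod_cast hN
  simp only [Finset.sum_const, Finset.card_univ, Fintype.card_fin, nsmul_eq_mul, integral_const,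
    probReal_univ, one_smul] at h4
  exact le_of_mul_le_mul_left (by linarith) hN'

lemma lambdaMin_pos (hDw : BoundedAdmissible D w) (hφ : IsOrthonormal D w φ) (hμ : μ ≪ volume) :
    0 < lambdaMin (gramR D φ v) := by
  have : Nonempty (Fin N) := ⟨⟨0, hN⟩⟩
  refine sInf_spectrum_pos (gramR_isSymm hI) fun x hx => ?_
  rw [dotProduct_gramR hI hN]
  exact expansion_sq_pos_of_ne_zero hN hDw hφ hμ hx

omit [IsProbabilityMeasure μ] in
lemma sum_sq_gramR_mulVec_le (hl : 0 ≤ lambdaMin (gramR D φ v)) (y : Fin N → ℝ) :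
    ∑ m, (gramR D φ v *ᵥ y) m ^ 2 ≤ lambdaMax (gramR D φ v) ^ 2 * (y ⬝ᵥ y) := by
  have : Nonempty (Fin N) := ⟨⟨0, hN⟩⟩
  have := dotProduct_self_mulVec_le_sSup_spectrum (gramR_isSymm hI) hl y
  simpa [dotProduct, sq, lambdaMax] using this

end Gram

open ProbabilityTheory in
/-- Mean square of the empirical moments. -/
lemma integral_empiricalMoment_sq_le [IsProbabilityMeasure μ] {Ω : Type*} [MeasurableSpace Ω]
    {ρ : Measure Ω} [IsProbabilityMeasure ρ] (hS : S ≠ 0) {Z : Fin S → Ω → Fin d → ℝ}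
    (hZ : ∀ s, Measurable (Z s)) (hind : iIndepFun Z ρ) (hlaw : ∀ s, Measure.map (Z s) ρ = μ)
    {g : (Fin d → ℝ) → ℝ} (hg_meas : AEMeasurable g μ)
    (hg : Integrable (fun z => christoffelWeight φ z * g z ^ 2) μ) :
    Integrable (fun ω => ∑ m, empiricalMoment φ g (fun s => Z s ω) m ^ 2) ρ ∧
      ∫ ω, ∑ m, empiricalMoment φ g (fun s => Z s ω) m ^ 2 ∂ρ ≤
        (N / S : ℝ) * ∫ z, christoffelWeight φ z * g z ^ 2 ∂μ +
          ∑ m, (∫ z, christoffelWeight φ z * (g z * basisVec φ z m) ∂μ) ^ 2 := by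
  have h := fun m => integral_sq_average_le hS hZ hind hlaw
    (memLp_christoffelWeight_mul hg_meas hg m (φ := φ))
  refine ⟨integrable_finsetSum _ fun m _ => (h m).1, ?_⟩
  refine (integral_finsetSum _ fun m _ => (h m).1).trans_le ?_
  refine (Finset.sum_le_sum fun m _ => (h m).2).trans ?_
  rw [Finset.sum_add_distrib, ← Finset.mul_sum]
  refine add_le_add ?_ le_rfl
  have := sum_integral_sq_le hg_meas hg (φ := φ)
  calc _ ≤ (1 / (S : ℝ)) * (N * ∫ z, christoffelWeight φ z * g z ^ 2 ∂μ) := by gcongr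
    _ = _ := by ring

end CLS

/-! ### The error bound. -/

theorem mainTheorem1
    {d N S : ℕ} (hN : 0 < N)
    -- the bounded admissible pair, with `w` a probability density on `D`
    {D : Set (Fin d → ℝ)} {w : (Fin d → ℝ) → ℝ} (hDw : CLS.BoundedAdmissible D w)
    (hw : ∫ z in D, w z = 1)
    -- an orthonormal basis of the polynomial space `P`
    {P : Submodule ℝ (MvPolynomial (Fin d) ℝ)}
    {φ : Fin N → MvPolynomial (Fin d) ℝ} (hφ : CLS.IsOrthonormal D w φ)
    (hP : Submodule.span ℝ (Set.range φ) = P)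
    -- the equilibrium measure of `D` and its Lebesgue density
    {μ : Measure (Fin d → ℝ)} (hμ : CLS.IsEquilibriumMeasure D μ)
    {v : (Fin d → ℝ) → ℝ} (hv_meas : Measurable v) (hv_nonneg : ∀ z, 0 ≤ v z)
    (hv : μ = volume.withDensity fun z => ENNReal.ofReal (v z))
    -- the function to be approximated
    {f : (Fin d → ℝ) → ℝ} (hf_meas : AEMeasurable f (volume.restrict D))
    {L : ℝ} (hfL : ∀ z ∈ D, |f z| ≤ L)
    (hf : IntegrableOn (fun z => f z ^ 2 * CLS.effWeight φ v z) D)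
    -- its orthogonal projections onto `P` in `L²_w` and in `L²_w̃`
    {pf ptf : MvPolynomial (Fin d) ℝ} (hpf : CLS.IsProjection D w P f pf)
    (hptf : CLS.IsProjection D (CLS.effWeight φ v) P f ptf)
    -- independent samples from the equilibrium measure
    {Ω : Type*} [MeasurableSpace Ω] {ℙ : Measure Ω} [IsProbabilityMeasure ℙ]
    {Z : Fin S → Ω → Fin d → ℝ} (hZ_meas : ∀ s, Measurable (Z s))
    (hZ_indep : ProbabilityTheory.iIndepFun Z ℙ) (hZ_law : ∀ s, Measure.map (Z s) ℙ = μ)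
    -- the coefficients of the least-squares estimator (any measurable choice of minimizer)
    {c : Ω → Fin N → ℝ} (hc_meas : AEMeasurable c ℙ)
    (hc : ∀ᵐ ω ∂ℙ, CLS.IsCLSSolution φ f (fun s => Z s ω) (c ω))
    -- the sampling criterion
    {r δ : ℝ} (hr : 0 < r) (hδ : 0 < δ) (hδ' : δ ≤ 1 / 2)
    (hS : (S : ℝ) / (N * Real.log S) ≥
      (1 + r) / CLS.cDelta δ * (1 / CLS.lambdaMin (CLS.gramR D φ v))) :
    Integrable (fun ω =>
        CLS.wNormSq D w fun z => f z - CLS.trunc L (CLS.expansion φ (c ω) z)) ℙ ∧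
      ∫ ω, CLS.wNormSq D w (fun z => f z - CLS.trunc L (CLS.expansion φ (c ω) z)) ∂ℙ ≤
        CLS.wNormSq D w (fun z => f z - MvPolynomial.eval z pf) +
          CLS.epsS r S / CLS.lambdaMin (CLS.gramR D φ v) *
            CLS.wNormSq D (CLS.effWeight φ v) (fun z => f z - MvPolynomial.eval z pf) +
          8 * L ^ 2 / (S : ℝ) ^ r +
          4 * CLS.condNum (CLS.gramR D φ v) ^ 2 *
            CLS.wNormSq D w (fun z => MvPolynomial.eval z ptf - MvPolynomial.eval z pf) ∧
      Tendsto (CLS.epsS r) atTop (𝓝 0) := by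
  have hμp := hμ.prob
  have hDm := hDw.measurableSet
  have hv' := CLS.eq_withDensity_restrict hDm hμ.compl_eq_zero hv
  have hμD : μ ≪ volume.restrict D := hv' ▸ withDensity_absolutelyContinuous _ _
  have hμv : μ ≪ volume := hv ▸ withDensity_absolutelyContinuous _ _
  have hI := CLS.integral_eq_setIntegral_mul hv_meas hv_nonneg hv'
  obtain ⟨x₀, hx₀⟩ := hDw.interior_nonempty
  have hL : 0 ≤ L := (abs_nonneg _).trans (hfL x₀ (interior_subset hx₀))
  have hfs : AEStronglyMeasurable f (volume.restrict D) := hf_meas.aestronglyMeasurable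
  have hfμ : AEMeasurable f μ := hf_meas.mono_ac hμD
  obtain ⟨a, ha⟩ := CLS.exists_eval_eq_expansion hP hpf.1
  obtain ⟨b, hb⟩ := CLS.exists_eval_eq_expansion hP hptf.1
  simp only [ha, hb]
  have hfint : Integrable (fun z => CLS.christoffelWeight φ z * f z ^ 2) μ := by
    rw [CLS.integrable_iff_integrableOn_mul hv_meas hv_nonneg hv']
    refine hf.congr (Eventually.of_forall fun z => ?_)
    simp only [CLS.effWeight, CLS.christoffelWeight]
    ring
  set R := CLS.gramR D φ v with hR
  set l := CLS.lambdaMin R with hl_def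
  have hl : 0 < l := CLS.lambdaMin_pos hI hN hDw hφ hμv
  have hl1 : l ≤ 1 := CLS.lambdaMin_le_one hI hN
  have hS2 := CLS.two_le_of_sampling hr hδ hδ' hl hS
  have hS0 : S ≠ 0 := by omega
  set g : (Fin d → ℝ) → ℝ := fun z => f z - CLS.expansion φ a z with hg_def
  have hgμ : AEMeasurable g μ := hfμ.sub (CLS.measurable_expansion a).aemeasurable
  have hgint : Integrable (fun z => CLS.christoffelWeight φ z * g z ^ 2) μ :=
    CLS.integrable_christoffelWeight_mul_sub_expansion_sq hfμ hfint a
  have hfa : ∀ y, CLS.wInner D w g (CLS.expansion φ y) = 0 := fun y => by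
    have h := hpf.2 (∑ n, y n • φ n)
      (hP ▸ Submodule.sum_mem _ fun n _ => Submodule.smul_mem _ _ (Submodule.subset_span ⟨n, rfl⟩))
    simpa only [ha, ← CLS.expansion_eq_eval] using h
  -- Split g = (f − Π̃f) + (Π̃f − Πf): the first part has zero w̃-moments against P, and those of
  -- the second are given by R.
  have hmean : ∀ m, ∫ z, CLS.christoffelWeight φ z * (g z * CLS.basisVec φ z m) ∂μ =
      (R.mulVec (b - a)) m := fun m => by
    have h0 : ∫ z, CLS.christoffelWeight φ z *
        ((f z - CLS.expansion φ b z) * CLS.basisVec φ z m) ∂μ = 0 := by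
      have h := hptf.2 (φ m) (hP ▸ Submodule.subset_span ⟨m, rfl⟩)
      rw [CLS.wInner_effWeight hI] at h
      simp only [hb] at h
      exact h
    have i1 := (CLS.memLp_christoffelWeight_mul hgμ hgint m).integrable one_le_two
    have i2 := (CLS.memLp_christoffelWeight_mul
      (hfμ.sub (CLS.measurable_expansion b).aemeasurable)
      (CLS.integrable_christoffelWeight_mul_sub_expansion_sq hfμ hfint b) m).integrable one_le_two
    rw [CLS.gramR_mulVec hI hN, ← sub_zero (∫ z, _ ∂μ), ← h0]
    refine (integral_sub i1 i2).symm.trans (congrArg _ (funext fun z => ?_))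
    simp only [hg_def, CLS.expansion_sub, Pi.sub_apply]
    ring
  obtain ⟨hHint, hH⟩ := CLS.integral_empiricalMoment_sq_le (φ := φ) hS0 hZ_meas hZ_indep hZ_law
    hgμ hgint
  simp only [hmean] at hH
  obtain ⟨B, hBm, hBμ, hB⟩ := Matrix.exists_chernoff_bound (μ := μ)
    CLS.measurable_christoffelMatrix CLS.christoffelMatrix_isSymm (c := N)
    (by exact_mod_cast hN) CLS.christoffelMatrix_mul_self (CLS.lambdaMin_mul_le hI hN) hδ
    (by linarith : δ < 1) S
  set Bad : Set Ω := (fun ω s => Z s ω) ⁻¹' B with hBad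
  have hZm : Measurable fun ω s => Z s ω := measurable_pi_lambda _ hZ_meas
  have hBadm : MeasurableSet Bad := hZm hBm
  have hBadp : ℙ.real Bad ≤ 1 / (S : ℝ) ^ r := by
    have hlaw := (ProbabilityTheory.iIndepFun_iff_map_fun_eq_pi_map
      fun s => (hZ_meas s).aemeasurable).1 hZ_indep
    simp only [hZ_law] at hlaw
    rw [← hlaw, Measure.map_apply hZm hBm, Fintype.card_fin] at hBμ
    exact (ENNReal.toReal_le_of_le_ofReal (by positivity) hBμ).trans
      (CLS.mul_exp_le_of_sampling hN hr hδ hδ' hl hS hl1)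
  set F : Ω → ℝ := fun ω =>
    CLS.wNormSq D w fun z => f z - CLS.trunc L (CLS.expansion φ (c ω) z) with hF
  have hF0 : ∀ ω, 0 ≤ F ω := fun ω => CLS.wNormSq_nonneg hDw _
  have hFle : ∀ ω, F ω ≤ 4 * L ^ 2 := fun ω => CLS.wNormSq_sub_trunc_le_const hDw hw hfs hfL hL _
  have hFint : Integrable F ℙ := by
    refine Integrable.of_bound ((CLS.continuous_wNormSq_sub_trunc hDw hfs hfL
      hL).measurable.comp_aemeasurable hc_meas).aestronglyMeasurable (4 * L ^ 2)
      (Eventually.of_forall fun ω => ?_)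
    exact (Real.norm_of_nonneg (hF0 ω)).trans_le (hFle ω)
  set E := CLS.wNormSq D w g with hE
  have hE0 : 0 ≤ E := CLS.wNormSq_nonneg hDw _
  set H : Ω → ℝ := fun ω => ∑ m, CLS.empiricalMoment φ g (fun s => Z s ω) m ^ 2 with hHdef
  have hH0 : ∀ ω, 0 ≤ H ω := fun ω => Finset.sum_nonneg fun m _ => sq_nonneg _
  -- As H is nonnegative everywhere, it can be averaged over all of Ω, with no conditioning on the
  -- good event.
  have hbound : ∀ᵐ ω ∂ℙ, F ω ≤ E + 4 / l ^ 2 * H ω + Bad.indicator (fun _ => 4 * L ^ 2) ω := by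
    filter_upwards [hc] with ω hω
    have h1 : 0 ≤ 4 / l ^ 2 * H ω := mul_nonneg (by positivity) (hH0 ω)
    by_cases hωB : ω ∈ Bad
    · rw [Set.indicator_of_mem hωB]
      linarith [hFle ω]
    · rw [Set.indicator_of_notMem hωB]
      have h2 := CLS.wNormSq_sub_trunc_le (φ := φ) hDw hfs hfL hL (c ω)
      rw [CLS.wNormSq_sub_expansion hDw hφ ⟨hfs, L, hfL⟩ hfa] at h2
      have h3 := hω.error_le hS0 hδ' hl (hB _ hωB) a
      linarith
  refine ⟨hFint, ?_, CLS.tendsto_epsS hr⟩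
  have hind : Integrable (Bad.indicator fun _ => 4 * L ^ 2) ℙ :=
    (integrable_const _).indicator hBadm
  have h1 := integral_mono_ae hFint
    (((integrable_const E).add (hHint.const_mul (4 / l ^ 2))).add hind) hbound
  have h2 : ∫ ω, (E + 4 / l ^ 2 * H ω + Bad.indicator (fun _ => 4 * L ^ 2) ω) ∂ℙ =
      E + 4 / l ^ 2 * ∫ ω, H ω ∂ℙ + ℙ.real Bad * (4 * L ^ 2) := by
    refine (integral_add ((integrable_const E).add (hHint.const_mul (4 / l ^ 2))) hind).trans ?_
    rw [integral_indicator_const _ hBadm, smul_eq_mul]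
    congr 1
    refine (integral_add (integrable_const E) (hHint.const_mul (4 / l ^ 2))).trans ?_
    rw [integral_const_mul, integral_const, probReal_univ, one_smul]
  have hd : CLS.wNormSq D w (fun z => CLS.expansion φ b z - CLS.expansion φ a z) =
      dotProduct (b - a) (b - a) := by
    simp only [← CLS.expansion_sub]
    exact CLS.wNormSq_expansion hDw hφ _
  have h3 := CLS.sum_sq_gramR_mulVec_le hI hN hl.le (b - a)
  have hG0 : 0 ≤ ∫ z, CLS.christoffelWeight φ z * g z ^ 2 ∂μ :=
    integral_nonneg fun z => mul_nonneg (CLS.christoffelWeight_nonneg z) (sq_nonneg _)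
  rw [hd, CLS.wNormSq_effWeight hI]
  have h4 : 4 / l ^ 2 * ∫ ω, H ω ∂ℙ ≤
      CLS.epsS r S / l * (∫ z, CLS.christoffelWeight φ z * g z ^ 2 ∂μ) +
        4 * CLS.condNum R ^ 2 * (dotProduct (b - a) (b - a)) := by
    calc _ ≤ 4 / l ^ 2 * ((N / S : ℝ) * (∫ z, CLS.christoffelWeight φ z * g z ^ 2 ∂μ) +
          CLS.lambdaMax R ^ 2 * (dotProduct (b - a) (b - a))) := by
          gcongr
          exact hH.trans (by gcongr)
      _ = 4 / l ^ 2 * (N / S : ℝ) * (∫ z, CLS.christoffelWeight φ z * g z ^ 2 ∂μ) +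
          4 * CLS.condNum R ^ 2 * (dotProduct (b - a) (b - a)) := by
          rw [CLS.condNum, ← hl_def]
          ring
      _ ≤ _ := by
          gcongr
          exact CLS.four_div_le_epsS hN hr hδ hδ' hl hS
  -- The argument gives 4L²; the stated constant 8 leaves a factor of two.
  have h5 : ℙ.real Bad * (4 * L ^ 2) ≤ 8 * L ^ 2 / (S : ℝ) ^ r := by
    calc _ ≤ 1 / (S : ℝ) ^ r * (8 * L ^ 2) := by
          gcongr
          norm_num
      _ = _ := by ring
  have h6 := h1.trans_eq h2
  linarith
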